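/- Let $(X,T)$ be a tern: a set with a ternary operation, written $abcT$, such that for all $a,b,c,d\in X$: (A1) $abaT=b$; (A2L) $ab(bacT)T=c$; (A2M) $a(bcaT)bT=c$; (A2R) $(cabT)baT=c$; (A3L) $(abcT)cdT=[ab(bcdT)T](bcdT)dT$; (A3R) $ab(bcdT)T=a(abcT)[(abcT)cdT]T$. *Tern homology.* Let $R$ be a commutative unital ring and let $C_n(X)$ be the free $R$-module on $X^{n+2}$. For $x=(x_0,\dots,x_{n+1})$ and $0\le i\le n$ let $d_i^{L}x=(y_1,\dots,y_{n+1})$ with $y_k=x_k$ for $k>i$ and $y_k=x_{k-1}x_ky_{k+1}T$ for $k\le i$ (computed from right to left), and $d_i^{R}x=(z_0,\dots,z_n)$ with $z_k=x_k$ for $k\le i$ and $z_k=z_{k-1}x_kx_{k+1}T$ for $k>i$ (computed from left to right). Put $\partial_n=\sum_{i=0}^n(-1)^i(d_i^{L}-d_i^{R})$, and let $C_n^D(X)\subset C_n(X)$ be spanned by the tuples with $x_i=x_{i+2}$ for some $i$. Tern homology $H_n^T(X)$ is the homology of $(C_n(X)/C_n^D(X),\partial_n)$. *The chain of a colored diagram.*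 Let $D$ be an oriented classical knot diagram (considered up to orientation-preserving homeomorphism of the sphere, that is, as a planar signed Gauss code). A tern coloring $c$ assigns elements of $X$ to the regions of $D$ so that, at every crossing, each region $R_i$ around it satisfies $c(R_i)=c(R_j)c(R_k)c(R_l)T$, where $R_i,R_j$ are separated by the over-arc, $R_j,R_k$ by the under-arc, and $R_l$ is the fourth region. Co-orient the arcs by normal vectors pointing to the left. The ascending path of a crossing is the triple of regions $(r_1,r_2,r_3)$, where $r_1$ is the source region (both normals point away from it), $r_1$ and $r_2$ are separated by the under-arc, and $r_3$ is the target region (both normals point towards it). Let $z(D,c)=\sum \pm(c(r_1),c(r_2),c(r_3))\in C_1(X)$, the sum being taken over all crossings with their signs. **Claim.** 1. $z(D,c)$ represents a cycle of $C_*(X)/C_*^D(X)$. 2. If $D'$ is obtained from $D$ by a Reidemeister move of any type (all orientations and signs), then every coloring of $D$ extends from the outside of the disk of the move to exactly one coloring of $D'$, and vice versa. 3. If $(D,c)$ and $(D',c')$ are related by a finite sequence of Reidemeister moves in either direction (and changes of the base point or of the names of the crossings), where at every step the colors are kept outside the disk of the move, then $[z(D,c)]=[z(D',c')]$ in $H_1^T(X)$.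 4. If $(D',c')$ is obtained from $(D,c)$ by a third Reidemeister move, then $z(D',c')-z(D,c)=\pm\partial_2(x)$ in $C_1(X)$ for some $x\in X^4$. If all three crossings are positive and, before the move, the triangle lies to the left of the middle strand, let $a|b|c|d$ be the colors of the ascending path of the three strands: $a$ and $b$ are the colors on the right and on the left of the incoming bottom strand, $b$ and $c$ those on the right and on the left of the incoming middle strand, $c$ and $d$ those on the right and on the left of the incoming top strand. Then exactly $$z(D',c')-z(D,c)=\partial_2(a,b,c,d)=(b,c,d)-(a,abcT,(abcT)cdT)-(abcT,c,d)+(a,b,bcdT)+(ab(bcdT)T,bcdT,d)-(a,b,c).$$ -/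

import Mathlib

namespace TernKnot

universe u v

/-! ### Terns -/

/-- A tern: a set with a ternary operation `abcT = T a b c` satisfying A1, A2L, A2M, A2R, A3L
and A3R. -/
structure IsTern {X : Type u} (T : X → X → X → X) : Prop where
  A1 : ∀ a b, T a b a = b
  A2L : ∀ a b c, T a b (T b a c) = c
  A2M : ∀ a b c, T a (T b c a) b = c
  A2R : ∀ a b c, T (T c a b) b a = c
  A3L : ∀ a b c d, T (T a b c) c d = T (T a b (T b c d)) (T b c d) d
  A3R : ∀ a b c d, T a b (T b c d) = T a (T a b c) (T (T a b c) c d)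

/-! ### Tern homology -/

section Homology

/-- The free module on tuples of length `k`; the module `C_n(X)` is `Chain R X (n + 2)`. -/
abbrev Chain (R : Type v) [CommRing R] (X : Type u) (k : ℕ) : Type (max u v) :=
  (Fin k → X) →₀ R

/-- A tuple as a sequence; only the entries with index `< k + 1` are ever used. -/
def extend {X : Type u} {k : ℕ} (x : Fin (k + 1) → X) : ℕ → X := fun i => x (Fin.ofNat (k + 1) i)

/-- The left faces: `d_0` drops the first entry, and
`d_i x = d_{i-1} (x [x_i ↦ x_{i-1} x_i x_{i+1} T])`. -/
def leftFace {X : Type u} (T : X → X → X → X) : ℕ → (ℕ → X) → ℕ → X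
  | 0, x => fun k => x (k + 1)
  | i + 1, x => leftFace T i (Function.update x (i + 1) (T (x i) (x (i + 1)) (x (i + 2))))

/-- The right faces, computed from left to right: the entry number `k` of `d_i x` is `x_k` for
`k ≤ i`, and `z x_k x_{k+1} T` with `z` the previous entry for `k > i`. -/
def rightFace {X : Type u} (T : X → X → X → X) (i : ℕ) (x : ℕ → X) : ℕ → X
  | 0 => x 0
  | k + 1 => if k + 1 ≤ i then x (k + 1) else T (rightFace T i x k) (x (k + 1)) (x (k + 2))

/-- `d_i^{n,L}` on tuples. -/
def dL {X : Type u} (T : X → X → X → X) (n i : ℕ) (x : Fin (n + 2) → X) : Fin (n + 1) → X :=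
  fun k => leftFace T i (extend x) k

/-- `d_i^{n,R}` on tuples. -/
def dR {X : Type u} (T : X → X → X → X) (n i : ℕ) (x : Fin (n + 2) → X) : Fin (n + 1) → X :=
  fun k => rightFace T i (extend x) k

/-- The differential `∂_n = ∑_{i=0}^n (-1)^i (d_i^{n,L} - d_i^{n,R}) : C_n(X) → C_{n-1}(X)`. -/
noncomputable def boundary (R : Type v) [CommRing R] {X : Type u} (T : X → X → X → X) (n : ℕ) :
    Chain R X (n + 2) →ₗ[R] Chain R X (n + 1) :=
  Finsupp.linearCombination R fun x : Fin (n + 2) → X =>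
    ∑ i ∈ Finset.range (n + 1),
      (-1 : R) ^ i • (Finsupp.single (dL T n i x) (1 : R) - Finsupp.single (dR T n i x) 1)

/-- The degenerate chains: the span of the tuples with `x_i = x_{i+2}` for some `i`. -/
noncomputable def degenerate (R : Type v) [CommRing R] (X : Type u) (k : ℕ) : Submodule R (Chain R X k) :=
  Submodule.span R {z | ∃ x : Fin k → X, (∃ i j : Fin k, (j : ℕ) = i + 2 ∧ x i = x j) ∧
    z = Finsupp.single x 1}

/-- The normalized chains `C_n(X) / C_n^D(X)`. -/
abbrev NormChain (R : Type v) [CommRing R] (X : Type u) (n : ℕ) : Type (max u v) :=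
  Chain R X (n + 2) ⧸ degenerate R X (n + 2)

/-- The kernel of the differential induced by `∂_n` on `C_n(X) / C_n^D(X)`: the classes of the
chains `z` with `∂_n z` degenerate. -/
noncomputable def normCycles (R : Type v) [CommRing R] {X : Type u} (T : X → X → X → X) (n : ℕ) :
    Submodule R (NormChain R X n) :=
  ((degenerate R X (n + 1)).comap (boundary R T n)).map (degenerate R X (n + 2)).mkQ

/-- The image of the differential induced by `∂_{n+1}` in `C_n(X) / C_n^D(X)`. -/
noncomputable def normBoundaries (R : Type v) [CommRing R] {X : Type u} (T : X → X → X → X)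
    (n : ℕ) : Submodule R (NormChain R X n) :=
  (LinearMap.range (boundary R T (n + 1))).map (degenerate R X (n + 2)).mkQ

/-- Tern homology `H_n^T(X)`: cycles modulo boundaries in `C_n(X) / C_n^D(X)`. -/
abbrev TernHomology (R : Type v) [CommRing R] {X : Type u} (T : X → X → X → X) (n : ℕ) :
    Type (max u v) :=
  normCycles R T n ⧸ (normBoundaries R T n).submoduleOf (normCycles R T n)

/-- The homology class of a normalized cycle. -/
noncomputable def homologyClass (R : Type v) [CommRing R] {X : Type u} (T : X → X → X → X) (n : ℕ)
    (z : normCycles R T n) : TernHomology R T n :=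
  Submodule.Quotient.mk z

end Homology

/-! ### Oriented knot diagrams

An oriented knot diagram, up to orientation preserving homeomorphism of the sphere, is given by
its signed Gauss code: travelling along the knot from a base point (chosen away from the
crossings), one records each passage through a crossing: which crossing it is, whether one passes
over or under, and the sign of the crossing. A code of length `m` cuts the knot into the gaps
`0, …, m` between consecutive letters; gaps `0` and `m` are the two parts of the arc that
contains the base point. Every gap has a left and a right side with respect to the orientation of
the knot. Sides that meet in a corner of a crossing, or at the base point, belong to the same
region. -/

/-- A passage through the crossing `label`, over or under; `isPos` says whether the crossing is
positive. -/
@[ext]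
structure Letter where
  label : ℕ
  isOver : Bool
  isPos : Bool

/-- A gap together with one of its sides, `true` for left and `false` for right. -/
abbrev Side (w : List Letter) : Type := Fin (w.length + 1) × Bool

/-- The side `s` of the gap `g`, for `g ≤ w.length`. -/
def side (w : List Letter) (g : ℕ) (s : Bool) : Side w := (Fin.ofNat (w.length + 1) g, s)

/-- At a crossing of sign `p` whose over-passage is the letter number `j`, the half of the
over-strand that lies on the side `t` of the under-strand. At a positive crossing the over-strand
runs from the left to the right of the under-strand, so its incoming gap `j` is on the left, and
its outgoing gap `j + 1` on the right; at a negative crossing it is the other way round. -/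
def overArm (p : Bool) (j : ℕ) (t : Bool) : ℕ := if t = p then j else j + 1

/-- At a crossing of sign `p` whose under-passage is the letter number `i`, the half of the
under-strand that lies on the side `s` of the over-strand. At a positive crossing the
under-strand runs from the right to the left of the over-strand. -/
def underArm (p : Bool) (i : ℕ) (s : Bool) : ℕ := if s = p then i + 1 else i

/-- Two sides that meet at the base point or in a corner of a crossing. The corner on the side `s`
of the over-strand and on the side `t` of the under-strand is bounded by the arm of the
over-strand on the side `t` of the under-strand, and by the arm of the under-strand on the side
`s` of the over-strand. -/
inductive Glue (w : List Letter) : Side w → Side w → Prop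
  | base (s : Bool) : Glue w (side w w.length s) (side w 0 s)
  | corner {i j k : ℕ} {p : Bool} (hu : w[i]? = some ⟨k, false, p⟩)
      (ho : w[j]? = some ⟨k, true, p⟩) (s t : Bool) :
      Glue w (side w (overArm p j t) s) (side w (underArm p i s) t)

/-- The regions of the diagram: sides of gaps, up to the equivalence relation generated by
`Glue`. -/
def Region (w : List Letter) : Type := Quot (Glue w)

/-- The region on the side `s` of the gap `g`. -/
def region (w : List Letter) (g : ℕ) (s : Bool) : Region w := Quot.mk _ (side w g s)

/-- At the crossing of sign `p` with under-passage number `i`, the region on the side `s` of the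
over-strand and on the side `t` of the under-strand. -/
def quadrant (w : List Letter) (p : Bool) (i : ℕ) (s t : Bool) : Region w :=
  region w (underArm p i s) t

/-- An oriented knot diagram: a signed Gauss code in which every crossing is passed exactly once
over and once under, with the same sign, and which is realized by a curve on the sphere. The last
condition is Euler's formula `V - E + F = 2` for the projection, which has `n` crossings, `2 n`
edges and hence `n + 2` regions, where the length of the code is `2 n`. -/
structure KnotDiagram where
  code : List Letter
  nodup : (code.map fun a => (a.label, a.isOver)).Nodup
  paired : ∀ a ∈ code, (⟨a.label, !a.isOver, a.isPos⟩ : Letter) ∈ code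
  planar : 2 * Nat.card (Region code) = code.length + 4

/-! ### Colorings and the cycle of a colored diagram -/

/-- A coloring of the regions: around a crossing, the color of each of the four regions `R_i` is
`c(R_j) c(R_k) c(R_l) T`, where `R_i`, `R_j` are separated by the over-strand, `R_j`, `R_k` by the
under-strand, and `R_l` is the remaining region. -/
@[ext]
structure Coloring {X : Type u} (T : X → X → X → X) (D : KnotDiagram) where
  color : Region D.code → X
  rule : ∀ (i k : ℕ) (p : Bool), D.code[i]? = some ⟨k, false, p⟩ → ∀ s t : Bool,
    color (quadrant D.code p i s t) =
      T (color (quadrant D.code p i (!s) t)) (color (quadrant D.code p i (!s) (!t)))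
        (color (quadrant D.code p i s (!t)))

/-- The signed colored ascending path of a letter; a crossing is counted at its under-passage.
The co-orientation vectors point to the left, so the source region is on the right of both
strands, and the target region on the left of both; the middle region is separated from the
source region by the under-strand and from the target region by the over-strand. -/
noncomputable def ascendingPath (R : Type v) [CommRing R] {X : Type u} {T : X → X → X → X}
    {D : KnotDiagram} (c : Coloring T D) (i : ℕ) : Chain R X 3 :=
  match D.code[i]? with
  | some ⟨_, false, p⟩ =>
      Finsupp.single ![c.color (quadrant D.code p i false false),
        c.color (quadrant D.code p i false true), c.color (quadrant D.code p i true true)]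
        (if p then 1 else -1)
  | _ => 0

/-- The sum of the colored ascending paths over all crossings, taken with the signs of the
crossings. -/
noncomputable def knotChain (R : Type v) [CommRing R] {X : Type u} {T : X → X → X → X}
    {D : KnotDiagram} (c : Coloring T D) : Chain R X 3 :=
  ∑ i ∈ Finset.range D.code.length, ascendingPath R c i

/-- The chain of a colored diagram in `C_1(X) / C_1^D(X)`. -/
noncomputable def normKnotChain (R : Type v) [CommRing R] {X : Type u} {T : X → X → X → X}
    {D : KnotDiagram} (c : Coloring T D) : NormChain R X 1 :=
  (degenerate R X 3).mkQ (knotChain R c)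

/-! ### Reidemeister moves -/

/-- The data of a third Reidemeister move. The strands are `0` (bottom), `1` (middle), `2` (top),
and the crossings are `mb` (middle over bottom), `tb` (top over bottom), `tm` (top over middle);
`pos…` are their signs. Each strand passes two of the crossings in a row; the three gaps between
these two passages bound a triangular region, which lies on the side `sideB`, `sideM`, `sideT` of
the bottom, middle, top strand. The two halves of a strand at a crossing are told apart by the side
of the other strand on which they lie, and the one next to the triangle is the gap between
the two passages; this gap leaves the crossing that the strand meets first and enters the other
one. This gives two conditions for each strand (compare `overArm` and `underArm`). -/
structure TripleData where
  mb : ℕ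
  tb : ℕ
  tm : ℕ
  posMB : Bool
  posTB : Bool
  posTM : Bool
  sideB : Bool
  sideM : Bool
  sideT : Bool
  /-- the bottom strand meets `mb` before `tb` -/
  firstB : Bool
  /-- the middle strand meets `mb` before `tm` -/
  firstM : Bool
  /-- the top strand meets `tb` before `tm` -/
  firstT : Bool
  bottom_mb : firstB = true ↔ sideM = posMB
  bottom_tb : firstB = false ↔ sideT = posTB
  middle_mb : firstM = true ↔ sideB ≠ posMB
  middle_tm : firstM = false ↔ sideT = posTM
  top_tb : firstT = true ↔ sideB ≠ posTB
  top_tm : firstT = false ↔ sideM ≠ posTM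
  /-- the order in which the knot runs through the three strands -/
  order : Equiv.Perm (Fin 3)
  /-- the parts of the code between the strands -/
  x₀ : List Letter
  x₁ : List Letter
  x₂ : List Letter
  x₃ : List Letter

namespace TripleData

variable (M : TripleData)

/-- The two passages of a strand before the move. -/
def strand (v : Fin 3) : List Letter :=
  match v with
  | 0 => if M.firstB then [⟨M.mb, false, M.posMB⟩, ⟨M.tb, false, M.posTB⟩]
      else [⟨M.tb, false, M.posTB⟩, ⟨M.mb, false, M.posMB⟩]
  | 1 => if M.firstM then [⟨M.mb, true, M.posMB⟩, ⟨M.tm, false, M.posTM⟩]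
      else [⟨M.tm, false, M.posTM⟩, ⟨M.mb, true, M.posMB⟩]
  | 2 => if M.firstT then [⟨M.tb, true, M.posTB⟩, ⟨M.tm, true, M.posTM⟩]
      else [⟨M.tm, true, M.posTM⟩, ⟨M.tb, true, M.posTB⟩]

/-- The code before the move. -/
def before : List Letter :=
  M.x₀ ++ M.strand (M.order 0) ++ M.x₁ ++ M.strand (M.order 1) ++ M.x₂ ++ M.strand (M.order 2)
    ++ M.x₃

/-- The code after the move: every strand meets its two crossings in the opposite order. -/
def after : List Letter :=
  M.x₀ ++ (M.strand (M.order 0)).reverse ++ M.x₁ ++ (M.strand (M.order 1)).reverse ++ M.x₂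
    ++ (M.strand (M.order 2)).reverse ++ M.x₃

/-- The gap that leads into the strand `v`. The next gap is the side of the triangle. -/
def entry (v : Fin 3) : ℕ :=
  match M.order.symm v with
  | 0 => M.x₀.length
  | 1 => M.x₀.length + 2 + M.x₁.length
  | 2 => M.x₀.length + 2 + M.x₁.length + 2 + M.x₂.length

end TripleData

/-- `Move w w' r`: the code `w'` is obtained from `w` by a Reidemeister move, or by a change of the
base point or of the names of the crossings. `r g g'` says that the gap `g` of `w` and the gap
`g'` of `w'` contain a common piece of the knot outside the disk in which the move takes place. -/
inductive Move : List Letter → List Letter → (ℕ → ℕ → Prop) → Prop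
  /-- Change of the base point. -/
  | rotate (x y : List Letter) :
      Move (x ++ y) (y ++ x) fun g g' =>
        (g ≤ x.length ∧ g' = g + y.length) ∨ (x.length ≤ g ∧ g' + x.length = g)
  /-- Change of the names of the crossings. -/
  | relabel (w : List Letter) (f : Equiv.Perm ℕ) :
      Move w (w.map fun a => ⟨f a.label, a.isOver, a.isPos⟩) fun g g' => g' = g
  /-- First move: a kink with a crossing of any sign, passed first over or first under. -/
  | one (x y : List Letter) (k : ℕ) (o p : Bool) :
      Move (x ++ y) (x ++ [⟨k, o, p⟩, ⟨k, !o, p⟩] ++ y) fun g g' =>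
        (g ≤ x.length ∧ g' = g) ∨ (x.length ≤ g ∧ g' = g + 2)
  /-- Second move: the gaps `e = x.length` and `f = x.length + y.length` border a common region,
  on the side `a` of `e` and on the side `b` of `f`, and `e` is pushed across this region over
  (`o = true`) or under (`o = false`) `f`. As `e` comes from the side `b` of `f`, the first
  crossing that it meets is positive if and only if `b = o`. The arc `f` meets the two crossings in
  the same order as `e` if and only if `a ≠ b`. -/
  | two (x y z : List Letter) (k l : ℕ) (o a b : Bool)
      (h : region (x ++ y ++ z) x.length a = region (x ++ y ++ z) (x.length + y.length) b) :
      Move (x ++ y ++ z)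
        (x ++ [⟨k, o, b == o⟩, ⟨l, o, !(b == o)⟩] ++ y ++
          (if a = b then [⟨l, !o, !(b == o)⟩, ⟨k, !o, b == o⟩]
            else [⟨k, !o, b == o⟩, ⟨l, !o, !(b == o)⟩]) ++ z)
        fun g g' => (g ≤ x.length ∧ g' = g) ∨
          (x.length ≤ g ∧ g ≤ x.length + y.length ∧ g' = g + 2) ∨
          (x.length + y.length ≤ g ∧ g' = g + 4)
  /-- Third move, of any type. -/
  | three (M : TripleData) :
      Move M.before M.after fun g g' => g' = g ∧ ∀ v, g ≠ M.entry v + 1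

/-- Two colorings agree outside the disk of a move with relation of gaps `r`. -/
def Agree {X : Type u} {T : X → X → X → X} {D D' : KnotDiagram} (r : ℕ → ℕ → Prop)
    (c : Coloring T D) (c' : Coloring T D') : Prop :=
  ∀ g g' : ℕ, g ≤ D.code.length → r g g' → ∀ s : Bool,
    c.color (region D.code g s) = c'.color (region D'.code g' s)

/-- A Reidemeister move of colored diagrams: the colors outside the disk of the move are kept. -/
def ColoredMove {X : Type u} (T : X → X → X → X)
    (P Q : (D : KnotDiagram) × Coloring T D) : Prop :=
  ∃ r, Move P.1.code Q.1.code r ∧ Agree r P.2 Q.2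

end TernKnot

/-! Everything is local at crossings. By A2, `T` is invertible in each argument, so three of the
four colors around a crossing determine the fourth, and the four equations there are equivalent
(`IsTern.rule_of_eq`). Attach to an arc the pair (color on its right, color on its left). The
boundary of a signed ascending path is the sum of the pairs of the two incoming arms minus that of
the two outgoing arms (`Crossing.boundary_crossingTerm`). Over the whole diagram this telescopes
along the knot, so the chain is a cycle even before degenerate chains are divided out.

For the moves, a coloring is encoded as a function on gaps (`IsColoring`). Apart from closing up at
the base point, the coloring condition depends only on the collection of passages, that is, letters
with the colors of the two adjacent gaps; so does the chain. The conditions inside the disk of a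
move separate from the others (`compat_append`), and each move becomes a statement about its disk: -
First move: two opposite quadrants are the same region, and A1 makes the other two equal, so the
kink is colored uniquely and its path is degenerate. - Second move: both crossings see the same four
colors with opposite signs, so their terms cancel. - Third move: the sides of the three strands
index the vertices of a cube. The triangle is one vertex before the move and the opposite vertex
after it; the three crossings are the faces at that vertex. By A2 and A3, three faces at a vertex
extend uniquely to a cube (`IsTern.exists_isCube`, `IsCube.ext_of_vertex`), which transports colors
across the move. A cube is determined by a path `a`, `b`, `c`, `d` from its source to its target
vertex, and the six terms of the boundary of this tuple are the paths of its six faces, with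
opposite signs on opposite faces; hence the difference of the chains is this boundary up to sign
(`TripleData.triangleChain_sub`).

`Transport` collects these facts for a pair of codes; passing to diagrams, homology and sequences of
moves is then formal. -/

namespace TernKnot

/-! ### Crossings, kinks and clasps -/

section Local

variable {X : Type*} {T : X → X → X → X}

/-- The coloring rule at a crossing, for the colors `q s t` of the region on the side `s` of the
over-strand and on the side `t` of the under-strand. -/
def Rule (T : X → X → X → X) (q : Bool → Bool → X) : Prop :=
  ∀ s t, q s t = T (q (!s) t) (q (!s) (!t)) (q s (!t))

/-- A2L, A2M and A2R solve the given equation for each of its three arguments, and the solutions are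
exactly the equations at the other three quadrants. -/
theorem IsTern.rule_of_eq (hT : IsTern T) {q : Bool → Bool → X} (s t : Bool)
    (h : q s t = T (q (!s) t) (q (!s) (!t)) (q s (!t))) : Rule T q := by
  have h₁ : q (!s) t = T (q s t) (q s (!t)) (q (!s) (!t)) := by rw [h, hT.A2R]
  have h₂ : q (!s) (!t) = T (q s (!t)) (q s t) (q (!s) t) := by rw [h, hT.A2M]
  have h₃ : q s (!t) = T (q (!s) (!t)) (q (!s) t) (q s t) := by rw [h, hT.A2L]
  intro s' t'
  cases s <;> cases t <;> cases s' <;> cases t' <;> assumption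

/-- The colors on both sides of the two halves `u₀`, `u₁` of the under-strand and of the two halves
`o₀`, `o₁` of the over-strand of a crossing of sign `p` fit together. -/
def Crossing (T : X → X → X → X) (p : Bool) (u₀ u₁ o₀ o₁ : Bool → X) : Prop :=
  ∃ q, Rule T q ∧ u₀ = q (!p) ∧ u₁ = q p ∧ o₀ = (fun s => q s p) ∧ o₁ = fun s => q s (!p)

/-- A first Reidemeister move: a strand with colors `e₀`, `e₁`, `e₂` before, inside and after the
kink. -/
def Kink (T : X → X → X → X) (o p : Bool) (e₀ e₁ e₂ : Bool → X) : Prop :=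
  if o then Crossing T p e₁ e₂ e₀ e₁ else Crossing T p e₀ e₁ e₁ e₂

/-- The two quadrants beside the loop are one region, of color `x` say. If `y` is the color of the
quadrant facing the loop, the loop has color `xyxT`, which is `y` by A1. So the loop has the same
two colors as the strand, with the sides exchanged. -/
theorem IsTern.kink_iff (hT : IsTern T) {o p : Bool} {e₀ e₁ e₂ : Bool → X} :
    Kink T o p e₀ e₁ e₂ ↔ e₂ = e₀ ∧ e₁ = fun s => e₀ (!s) := by
  constructor
  · intro h
    cases o <;> cases p <;> obtain ⟨q, hq, h₀, h₁, h₂, h₃⟩ := h <;>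
      simp only [funext_iff, Bool.forall_bool, Rule, Bool.not_true, Bool.not_false] at * <;>
      have A := hT.A1 <;> grind
  · rintro ⟨rfl, rfl⟩
    cases o
    · refine ⟨fun s t => if s = p then e₂ (!t) else e₂ t, hT.rule_of_eq (!p) (!p) ?_, ?_⟩
      · cases p <;> simp [hT.A1]
      · cases p <;> simp [funext_iff]
    · refine ⟨fun s t => if s = p then e₂ t else e₂ (!t), hT.rule_of_eq (!p) (!p) ?_, ?_⟩
      · cases p <;> simp [hT.A1]
      · cases p <;> simp [funext_iff]

/-- A second Reidemeister move: the strands `e` and `f` cross twice, see `Move.two`. -/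
def Clasp (T : X → X → X → X) (o a b : Bool) (e₀ e₁ e₂ f₀ f₁ f₂ : Bool → X) : Prop :=
  if o then
    if a = b then Crossing T b f₁ f₂ e₀ e₁ ∧ Crossing T (!b) f₀ f₁ e₁ e₂
    else Crossing T b f₀ f₁ e₀ e₁ ∧ Crossing T (!b) f₁ f₂ e₁ e₂
  else
    if a = b then Crossing T (!b) e₀ e₁ f₁ f₂ ∧ Crossing T b e₁ e₂ f₀ f₁
    else Crossing T (!b) e₀ e₁ f₀ f₁ ∧ Crossing T b e₁ e₂ f₁ f₂

/-- The colors along the half of the over-strand (`o = true`) or of the under-strand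
(`o = false`) on the side `c` of the other strand. -/
def arm (q : Bool → Bool → X) (o c : Bool) : Bool → X :=
  if o then fun s => q s c else q c

/-- The two crossings share the gaps `e₁` and `f₁` of the bigon, hence the colors of three
quadrants, and the rule forces the fourth ones to agree. One `q` therefore describes both crossings,
and each strand leaves with the colors with which it came. -/
theorem Clasp.exists_rule {o a b : Bool} {e₀ e₁ e₂ f₀ f₁ f₂ : Bool → X}
    (h : Clasp T o a b e₀ e₁ e₂ f₀ f₁ f₂) : ∃ q, Rule T q ∧ e₀ = arm q o b ∧ e₂ = arm q o b ∧
      f₀ = arm q (!o) a ∧ f₂ = arm q (!o) a ∧ e₁ = arm q o (!b) ∧ f₁ = arm q (!o) (!a) := by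
  cases o <;> cases a <;> cases b <;>
    obtain ⟨⟨q, hq, h₀, h₁, h₂, h₃⟩, ⟨q', hq', h₀', h₁', h₂', h₃'⟩⟩ := h <;>
    refine ⟨q, hq, ?_⟩ <;>
    simp only [funext_iff, Bool.forall_bool, Rule, Bool.not_true, Bool.not_false, arm, if_true,
      Bool.false_eq_true, if_false] at * <;>
    grind

theorem Rule.clasp {q : Bool → Bool → X} (hq : Rule T q) (o a b : Bool) :
    Clasp T o a b (arm q o b) (arm q o (!b)) (arm q o b) (arm q (!o) a) (arm q (!o) (!a))
      (arm q (!o) a) := by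
  cases o <;> cases a <;> cases b <;>
    exact ⟨⟨q, hq, rfl, rfl, rfl, rfl⟩, ⟨q, hq, rfl, rfl, rfl, rfl⟩⟩

/-- The two strands supply three quadrants, `h` being their consistency at the common region; the
fourth is computed by `T`. -/
theorem IsTern.exists_rule_arm (hT : IsTern T) (o : Bool) {a b : Bool} {e f : Bool → X}
    (h : e a = f b) : ∃ q, Rule T q ∧ e = arm q o b ∧ f = arm q (!o) a := by
  cases o
  · refine ⟨fun s t => if s = b then e t else if t = a then f s else T (e (!a)) (e a) (f (!b)),
      hT.rule_of_eq (!b) (!a) ?_, ?_⟩ <;>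
    cases a <;> cases b <;> simp_all [funext_iff, arm]
  · refine ⟨fun s t => if t = b then e s else if s = a then f t else T (f (!b)) (e a) (e (!a)),
      hT.rule_of_eq (!a) (!b) ?_, ?_⟩ <;>
    cases a <;> cases b <;> simp_all [funext_iff, arm]

theorem Rule.ext_of_arm {q q' : Bool → Bool → X} (hq : Rule T q) (hq' : Rule T q') {o a b : Bool}
    (h₁ : arm q o b = arm q' o b) (h₂ : arm q (!o) a = arm q' (!o) a) : q = q' := by
  have h := hq (if o then !a else !b) (if o then !b else !a)
  have h' := hq' (if o then !a else !b) (if o then !b else !a)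
  cases o <;> cases a <;> cases b <;>
    simp only [funext_iff, Bool.forall_bool, Bool.not_true, Bool.not_false, arm, if_true,
      Bool.false_eq_true, if_false] at * <;>
    grind

end Local

end TernKnot

namespace TernKnot

/-! ### Cubes and the third Reidemeister move -/

section Cube

variable {X : Type*} {T : X → X → X → X}

/-- Colors `col b m t` of the eight regions into which three strands can cut a disk, on the side `b`
of the bottom, `m` of the middle and `t` of the top strand, such that the rule holds at the six
crossings. -/
def IsCube (T : X → X → X → X) (col : Bool → Bool → Bool → X) : Prop :=
  (∀ t, Rule T fun m b => col b m t) ∧ (∀ m, Rule T fun t b => col b m t) ∧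
    ∀ b, Rule T fun t m => col b m t

/-- The cube with the ascending path `a`, `b`, `c`, `d`. -/
def pathCube (T : X → X → X → X) (a b c d : X) : Bool → Bool → Bool → X
  | false, false, false => a
  | true, false, false => b
  | true, true, false => c
  | true, true, true => d
  | false, true, false => T a b c
  | true, false, true => T b c d
  | false, true, true => T (T a b c) c d
  | false, false, true => T a b (T b c d)

/-- Four faces hold by the very definition of the computed colors. The face on the left of the top
strand is A3L, the face on the right of the bottom strand is A3R. -/
theorem IsTern.isCube_pathCube (hT : IsTern T) (a b c d : X) : IsCube T (pathCube T a b c d) := by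
  refine ⟨Bool.forall_bool.2 ⟨?_, ?_⟩, Bool.forall_bool.2 ⟨?_, ?_⟩, Bool.forall_bool.2 ⟨?_, ?_⟩⟩ <;>
    refine hT.rule_of_eq true false ?_
  · rfl
  · exact hT.A3L a b c d
  · rfl
  · rfl
  · exact hT.A3R a b c d
  · rfl

/-- Three faces of a cube that meet in a vertex fit into a cube. -/
theorem IsTern.exists_isCube (hT : IsTern T) {col : Bool → Bool → Bool → X} {b m t : Bool}
    (hB : Rule T fun m' b' => col b' m' t) (hM : Rule T fun t' b' => col b' m t')
    (hT' : Rule T fun t' m' => col b m' t') :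
    ∃ col', IsCube T col' ∧ ∀ b' m' t', b' = b ∨ m' = m ∨ t' = t → col' b' m' t' = col b' m' t' := by
  have L := hT.A2L
  have M := hT.A2M
  have N := hT.A2R
  have P := hT.A3L
  have Q := hT.A3R
  set a₀ := col false false false with ha
  set a₁ := col true false false with hb
  set a₂ := col true true false with hc
  set a₃ := col true true true with hd
  set u := col false true false with hu
  set v := col true false true with hv
  set w := col false true true with hw
  set z := col false false true with hz
  -- The vertex opposite to `(b, m, t)` carries no information in `col`. If it lies on the path, its
  -- entry is recovered by inverting `T` on a face through it; otherwise the path is read off `col`.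
  obtain ⟨x₀, x₁, x₂, x₃, h⟩ : ∃ x₀ x₁ x₂ x₃, ∀ b' m' t', b' = b ∨ m' = m ∨ t' = t →
      pathCube T x₀ x₁ x₂ x₃ b' m' t' = col b' m' t' := by
    cases b <;> cases m <;> cases t
    · exact ⟨a₀, a₁, a₂, T a₂ a₁ v, by
        simp only [Rule, Bool.forall_bool, Bool.not_true, Bool.not_false, pathCube] at *; grind⟩
    · exact ⟨a₀, a₁, T a₃ v a₁, a₃, by
        simp only [Rule, Bool.forall_bool, Bool.not_true, Bool.not_false, pathCube] at *; grind⟩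
    · exact ⟨a₀, a₁, a₂, a₃, by
        simp only [Rule, Bool.forall_bool, Bool.not_true, Bool.not_false, pathCube] at *; grind⟩
    · exact ⟨a₀, T a₂ u a₀, a₂, a₃, by
        simp only [Rule, Bool.forall_bool, Bool.not_true, Bool.not_false, pathCube] at *; grind⟩
    · exact ⟨a₀, a₁, a₂, a₃, by
        simp only [Rule, Bool.forall_bool, Bool.not_true, Bool.not_false, pathCube] at *; grind⟩
    · exact ⟨a₀, a₁, a₂, a₃, by
        simp only [Rule, Bool.forall_bool, Bool.not_true, Bool.not_false, pathCube] at *; grind⟩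
    · exact ⟨a₀, a₁, a₂, a₃, by
        simp only [Rule, Bool.forall_bool, Bool.not_true, Bool.not_false, pathCube] at *; grind⟩
    · exact ⟨T u a₂ a₁, a₁, a₂, a₃, by
        simp only [Rule, Bool.forall_bool, Bool.not_true, Bool.not_false, pathCube] at *; grind⟩
  exact ⟨_, hT.isCube_pathCube x₀ x₁ x₂ x₃, h⟩

theorem IsCube.eq_pathCube {col : Bool → Bool → Bool → X} (h : IsCube T col) :
    col = pathCube T (col false false false) (col true false false) (col true true false)
      (col true true true) := by
  obtain ⟨h₁, h₂, h₃⟩ := h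
  have e₁ : col false true false = T (col false false false) (col true false false)
      (col true true false) := h₁ false true false
  have e₂ : col true false true = T (col true false false) (col true true false)
      (col true true true) := h₃ true true false
  have e₃ : col false true true = T (col false true false) (col true true false)
      (col true true true) := h₂ true true false
  have e₄ : col false false true = T (col false false false) (col true false false)
      (col true false true) := h₂ false true false
  funext b m t
  cases b <;> cases m <;> cases t <;> simp only [pathCube, ← e₁, ← e₂, ← e₃, ← e₄]

/-- A cube is determined by its faces at a vertex. -/
theorem IsCube.ext_of_vertex {col col' : Bool → Bool → Bool → X} (h : IsCube T col)
    (h' : IsCube T col') {b m t : Bool}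
    (e : ∀ b' m' t', b' = b ∨ m' = m ∨ t' = t → col b' m' t' = col' b' m' t') : col = col' := by
  -- Only the vertex opposite to `(b, m, t)` is missing, and this face expresses it through three
  -- known colors.
  have k := h.1 (!t) (!m) (!b)
  have k' := h'.1 (!t) (!m) (!b)
  funext b' m' t'
  by_cases hx : b' = b ∨ m' = m ∨ t' = t
  · exact e _ _ _ hx
  · simp only [not_or, ← Bool.eq_not] at hx
    obtain ⟨rfl, rfl, rfl⟩ := hx
    grind

end Cube

/-! ### The disk of a third move as a cube of colors. -/

namespace TripleData

section

variable {X : Type*} {T : X → X → X → X} (M : TripleData)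

/-- The third move in the opposite direction. -/
def flip : TripleData where
  mb := M.mb
  tb := M.tb
  tm := M.tm
  posMB := M.posMB
  posTB := M.posTB
  posTM := M.posTM
  sideB := !M.sideB
  sideM := !M.sideM
  sideT := !M.sideT
  firstB := !M.firstB
  firstM := !M.firstM
  firstT := !M.firstT
  bottom_mb := by have := M.bottom_mb; grind
  bottom_tb := by have := M.bottom_tb; grind
  middle_mb := by have := M.middle_mb; grind
  middle_tm := by have := M.middle_tm; grind
  top_tb := by have := M.top_tb; grind
  top_tm := by have := M.top_tm; grind
  order := M.order
  x₀ := M.x₀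
  x₁ := M.x₁
  x₂ := M.x₂
  x₃ := M.x₃

theorem strand_flip (v : Fin 3) : M.flip.strand v = (M.strand v).reverse := by
  fin_cases v
  · cases h : M.firstB <;> simp [strand, flip, h]
  · cases h : M.firstM <;> simp [strand, flip, h]
  · cases h : M.firstT <;> simp [strand, flip, h]

/-- With this, results about the code before a move also serve for the code after it and for the
inverse move. -/
theorem before_flip : M.flip.before = M.after := by
  simp only [before, after, strand_flip]
  rfl

theorem after_flip : M.flip.after = M.before := by
  simp only [before, after, strand_flip, List.reverse_reverse]
  rfl

theorem entry_flip : M.flip.entry = M.entry := rfl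

/-- The colors `i v`, `m v`, `o v` on both sides of the three gaps of the strand `v` fit together at
the three crossings. -/
def Triangle (T : X → X → X → X) (i m o : Fin 3 → Bool → X) : Prop :=
  Crossing T M.posMB (if M.firstB then i 0 else m 0) (if M.firstB then m 0 else o 0)
    (if M.firstM then i 1 else m 1) (if M.firstM then m 1 else o 1) ∧
  Crossing T M.posTB (if M.firstB then m 0 else i 0) (if M.firstB then o 0 else m 0)
    (if M.firstT then i 2 else m 2) (if M.firstT then m 2 else o 2) ∧
  Crossing T M.posTM (if M.firstM then m 1 else i 1) (if M.firstM then o 1 else m 1)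
    (if M.firstT then m 2 else i 2) (if M.firstT then o 2 else m 2)

/-- The colors of the incoming gap of a strand. -/
def entryColors (col : Bool → Bool → Bool → X) : Fin 3 → Bool → X :=
  ![fun s => col s (M.sideM ^^ M.firstB) (M.sideT ^^ !M.firstB),
    fun s => col (M.sideB ^^ M.firstM) s (M.sideT ^^ !M.firstM),
    fun s => col (M.sideB ^^ M.firstT) (M.sideM ^^ !M.firstT) s]

/-- The colors of the gap of a strand at the triangle. -/
def midColors (col : Bool → Bool → Bool → X) : Fin 3 → Bool → X :=
  ![fun s => col s M.sideM M.sideT, fun s => col M.sideB s M.sideT, fun s => col M.sideB M.sideM s]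

/-- The colors of the outgoing gap of a strand. -/
def exitColors (col : Bool → Bool → Bool → X) : Fin 3 → Bool → X :=
  ![fun s => col s (M.sideM ^^ !M.firstB) (M.sideT ^^ M.firstB),
    fun s => col (M.sideB ^^ !M.firstM) s (M.sideT ^^ M.firstM),
    fun s => col (M.sideB ^^ !M.firstT) (M.sideM ^^ M.firstT) s]

/-- The incoming gap of a strand lies beyond the crossing met first and on the side of the triangle
at the other one. `flip` negates both the sides of the triangle and the order of the crossings, so
these sides do not change. -/
theorem entryColors_flip (col : Bool → Bool → Bool → X) :
    M.flip.entryColors col = M.entryColors col := by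
  simp [entryColors, flip]

theorem exitColors_flip (col : Bool → Bool → Bool → X) :
    M.flip.exitColors col = M.exitColors col := by
  simp [exitColors, flip]

/-- The sides of the triangle and one sign determine the other signs and the directions. -/
theorem eq_xor : M.posTB = !(M.sideM ^^ M.sideT ^^ M.posMB) ∧
    M.posTM = (M.sideB ^^ M.sideT ^^ M.posMB) ∧ M.firstB = !(M.sideM ^^ M.posMB) ∧
    M.firstM = (M.sideB ^^ M.posMB) ∧ M.firstT = !(M.sideB ^^ M.sideM ^^ M.sideT ^^ M.posMB) := by
  have h₁ := M.bottom_mb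
  have h₂ := M.bottom_tb
  have h₃ := M.middle_mb
  have h₄ := M.middle_tm
  have h₅ := M.top_tb
  have h₆ := M.top_tm
  generalize M.posMB = p₁, M.posTB = p₂, M.posTM = p₃, M.sideB = b, M.sideM = m, M.sideT = t,
    M.firstB = c₁, M.firstM = c₂, M.firstT = c₃ at *
  cases b <;> cases m <;> cases t <;> cases p₁ <;> simp at h₁ h₃ <;> grind

/-- The crossing of two strands lies on the same side of the third strand as the triangle, so the
three crossings are the faces of the cube at the vertex of the triangle. -/
theorem _root_.TernKnot.IsCube.triangle {col : Bool → Bool → Bool → X} (h : IsCube T col) :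
    M.Triangle T (M.entryColors col) (M.midColors col) (M.exitColors col) := by
  obtain ⟨h₂, h₃, k₁, k₂, k₃⟩ := M.eq_xor
  refine ⟨⟨_, h.1 M.sideT, ?_⟩, ⟨_, h.2.1 M.sideM, ?_⟩, ⟨_, h.2.2 M.sideB, ?_⟩⟩
  all_goals
    simp only [entryColors, midColors, exitColors, Matrix.cons_val, h₂, h₃, k₁, k₂, k₃]
    generalize M.posMB = p, M.sideB = b, M.sideM = m, M.sideT = t
    cases b <;> cases m <;> cases t <;> cases p <;> exact ⟨rfl, rfl, rfl, rfl⟩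

theorem Triangle.exists_isCube (hT : IsTern T) {i m o : Fin 3 → Bool → X}
    (h : M.Triangle T i m o) : ∃ col, IsCube T col ∧ i = M.entryColors col ∧
      m = M.midColors col ∧ o = M.exitColors col := by
  obtain ⟨⟨q₁, hq₁, h₁⟩, ⟨q₂, hq₂, h₂⟩, ⟨q₃, hq₃, h₃⟩⟩ := h
  obtain ⟨col, hB, hM, hT'⟩ : ∃ col : Bool → Bool → Bool → X,
      (fun m b => col b m M.sideT) = q₁ ∧ (fun t b => col b M.sideM t) = q₂ ∧
      (fun t m => col M.sideB m t) = q₃ := by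
    -- Neighboring faces share the gap of a strand at the triangle, so the three rules glue. The
    -- value at the vertex opposite to the triangle is arbitrary; `exists_isCube` replaces it.
    refine ⟨fun b m t => if t = M.sideT then q₁ m b else if m = M.sideM then q₂ t b else q₃ t m,
      ?_⟩
    obtain ⟨j₂, j₃, k₁, k₂, k₃⟩ := M.eq_xor
    simp only [j₂, j₃, k₁, k₂, k₃] at h₁ h₂ h₃ ⊢
    generalize M.posMB = p, M.sideB = b, M.sideM = m, M.sideT = t at *
    cases b <;> cases m <;> cases t <;> cases p <;>
      simp [funext_iff] at h₁ h₂ h₃ ⊢ <;> grind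
  subst hB hM hT'
  obtain ⟨col', hc, e⟩ := hT.exists_isCube hq₁ hq₂ hq₃
  refine ⟨col', hc, ?_⟩
  have e₁ : ∀ b m, col' b m M.sideT = col b m M.sideT := fun b m => e _ _ _ (by simp)
  have e₂ : ∀ b t, col' b M.sideM t = col b M.sideM t := fun b t => e _ _ _ (by simp)
  have e₃ : ∀ m t, col' M.sideB m t = col M.sideB m t := fun m t => e _ _ _ (by simp)
  clear e hc hq₁ hq₂ hq₃
  obtain ⟨j₂, j₃, k₁, k₂, k₃⟩ := M.eq_xor
  simp only [entryColors, midColors, exitColors, funext_iff, Fin.forall_fin_succ] at h₁ h₂ h₃ ⊢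
  simp only [j₂, j₃, k₁, k₂, k₃] at h₁ h₂ h₃ ⊢
  generalize M.posMB = p, M.sideB = b, M.sideM = m, M.sideT = t at *
  cases b <;> cases m <;> cases t <;> cases p <;>
    simp [e₁, e₂, e₃] at h₁ h₂ h₃ ⊢ <;> grind

/-- The incoming and outgoing gaps touch all six regions other than the triangle and its opposite
vertex. The rule `r` gives the color of the triangle, and then three full faces are known. -/
theorem cube_unique {col col' : Bool → Bool → Bool → X} (h : IsCube T col) (h' : IsCube T col')
    (hi : M.entryColors col = M.entryColors col') (ho : M.exitColors col = M.exitColors col') :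
    col = col' := by
  obtain ⟨j₂, j₃, k₁, k₂, k₃⟩ := M.eq_xor
  have r := h.1 M.sideT M.sideM M.sideB
  have r' := h'.1 M.sideT M.sideM M.sideB
  refine h.ext_of_vertex h' (b := M.sideB) (m := M.sideM) (t := M.sideT) ?_
  simp only [entryColors, exitColors, k₁, k₂, k₃, funext_iff, Fin.forall_fin_succ] at hi ho
  generalize M.posMB = p, M.sideB = b, M.sideM = m, M.sideT = t at *
  simp only [Bool.forall_bool]
  cases b <;> cases m <;> cases t <;> cases p <;> simp at hi ho r r' ⊢ <;> grind

end

end TripleData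

end TernKnot

namespace TernKnot

/-! ### The chains of crossings -/

section Terms

variable (R : Type*) [CommRing R] {X : Type*} {T : X → X → X → X}

theorem boundary_one_single (a b c : X) :
    boundary R T 1 (Finsupp.single ![a, b, c] 1) = Finsupp.single ![b, c] 1 -
      Finsupp.single ![a, T a b c] 1 - Finsupp.single ![T a b c, c] 1 + Finsupp.single ![a, b] 1 := by
  have h₁ : dL T 1 0 ![a, b, c] = ![b, c] := by funext k; fin_cases k <;> rfl
  have h₂ : dR T 1 0 ![a, b, c] = ![a, T a b c] := by funext k; fin_cases k <;> rfl
  have h₃ : dL T 1 1 ![a, b, c] = ![T a b c, c] := by funext k; fin_cases k <;> rfl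
  have h₄ : dR T 1 1 ![a, b, c] = ![a, b] := by funext k; fin_cases k <;> rfl
  simp only [boundary, Finsupp.linearCombination_single, Finset.sum_range_succ, Finset.sum_range_zero,
    h₁, h₂, h₃, h₄, one_smul, pow_zero, pow_one, neg_smul]
  abel

theorem boundary_two_single (a b d e : X) :
    boundary R T 2 (Finsupp.single ![a, b, d, e] 1) =
      Finsupp.single ![b, d, e] 1 - Finsupp.single ![a, T a b d, T (T a b d) d e] 1
        - Finsupp.single ![T a b d, d, e] 1 + Finsupp.single ![a, b, T b d e] 1
        + Finsupp.single ![T a b (T b d e), T b d e, e] 1 - Finsupp.single ![a, b, d] 1 := by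
  have h₁ : dL T 2 0 ![a, b, d, e] = ![b, d, e] := by funext k; fin_cases k <;> rfl
  have h₂ : dR T 2 0 ![a, b, d, e] = ![a, T a b d, T (T a b d) d e] := by
    funext k; fin_cases k <;> rfl
  have h₃ : dL T 2 1 ![a, b, d, e] = ![T a b d, d, e] := by funext k; fin_cases k <;> rfl
  have h₄ : dR T 2 1 ![a, b, d, e] = ![a, b, T b d e] := by funext k; fin_cases k <;> rfl
  have h₅ : dL T 2 2 ![a, b, d, e] = ![T a b (T b d e), T b d e, e] := by
    funext k; fin_cases k <;> rfl
  have h₆ : dR T 2 2 ![a, b, d, e] = ![a, b, d] := by funext k; fin_cases k <;> rfl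
  simp only [boundary, Finsupp.linearCombination_single, Finset.sum_range_succ, Finset.sum_range_zero,
    h₁, h₂, h₃, h₄, h₅, h₆, one_smul, pow_zero, pow_one, neg_smul, even_two, Even.neg_pow, one_pow]
  abel

/-- The signed colored ascending path of a crossing of sign `p`, in terms of the colors of the
halves `u₀` and `u₁` of the under-strand. -/
noncomputable def crossingTerm (p : Bool) (u₀ u₁ : Bool → X) : Chain R X 3 :=
  Finsupp.single ![(if p then u₀ else u₁) false, (if p then u₀ else u₁) true,
    (if p then u₁ else u₀) true] (if p then 1 else -1)

theorem crossingTerm_eq (p : Bool) (q : Bool → Bool → X) :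
    crossingTerm R p (q (!p)) (q p) = (if p then (1 : R) else -1) •
      Finsupp.single ![q false false, q false true, q true true] (1 : R) := by
  cases p <;> simp [crossingTerm]

/-- The colors of the right and of the left side of a gap, as a chain. -/
noncomputable def gapChain (y : Bool → X) : Chain R X 2 :=
  Finsupp.single ![y false, y true] 1

/-- The four terms of the boundary of a path are the right and left colors along the four
half-strands. A negative crossing exchanges the two halves of each strand, which its sign
compensates. -/
theorem Crossing.boundary_crossingTerm {p : Bool} {u₀ u₁ o₀ o₁ : Bool → X}
    (h : Crossing T p u₀ u₁ o₀ o₁) : boundary R T 1 (crossingTerm R p u₀ u₁) =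
      (gapChain R u₀ - gapChain R u₁) + (gapChain R o₀ - gapChain R o₁) := by
  obtain ⟨q, hq, rfl, rfl, rfl, rfl⟩ := h
  have := hq true false
  simp only [Bool.not_true, Bool.not_false] at this
  rw [crossingTerm_eq, map_smul, boundary_one_single, ← this]
  cases p <;> simp [gapChain] <;> abel

/-- Source and target region are opposite quadrants, and at a kink opposite quadrants have equal
colors; so the path has the form `(x, y, x)`. -/
theorem IsTern.kink_crossingTerm_mem (hT : IsTern T) {o p : Bool} {e₀ e₁ e₂ : Bool → X}
    (h : Kink T o p e₀ e₁ e₂) :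
    (if o then crossingTerm R p e₁ e₂ else crossingTerm R p e₀ e₁) ∈ degenerate R X 3 := by
  obtain ⟨rfl, rfl⟩ := hT.kink_iff.1 h
  have key : ∀ (x y : X) (r : R), Finsupp.single ![x, y, x] r ∈ degenerate R X 3 := by
    intro x y r
    rw [← mul_one r, ← smul_eq_mul, ← Finsupp.smul_single]
    exact Submodule.smul_mem _ _ (Submodule.subset_span ⟨_, ⟨0, 2, rfl, rfl⟩, rfl⟩)
  cases o <;> cases p <;> exact key _ _ _

theorem Clasp.sum_crossingTerm {o a b : Bool} {e₀ e₁ e₂ f₀ f₁ f₂ : Bool → X}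
    (h : Clasp T o a b e₀ e₁ e₂ f₀ f₁ f₂) :
    (if o then (if a = b then crossingTerm R b f₁ f₂ + crossingTerm R (!b) f₀ f₁
        else crossingTerm R b f₀ f₁ + crossingTerm R (!b) f₁ f₂)
      else crossingTerm R (!b) e₀ e₁ + crossingTerm R b e₁ e₂) = 0 := by
  obtain ⟨q, -, rfl, rfl, rfl, rfl, rfl, rfl⟩ := h.exists_rule
  cases o <;> cases a <;> cases b <;> simp [arm, crossingTerm]

end Terms

/-! ### The chain of a third move and the boundary of a path. -/

namespace TripleData

variable (R : Type*) [CommRing R] {X : Type*} {T : X → X → X → X} (M : TripleData)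

/-- The chain of the three crossings of a third move. -/
noncomputable def triangleChain (i m o : Fin 3 → Bool → X) : Chain R X 3 :=
  crossingTerm R M.posMB (if M.firstB then i 0 else m 0) (if M.firstB then m 0 else o 0) +
  crossingTerm R M.posTB (if M.firstB then m 0 else i 0) (if M.firstB then o 0 else m 0) +
  crossingTerm R M.posTM (if M.firstM then m 1 else i 1) (if M.firstM then o 1 else m 1)

/-- The path of `mb` on the right of the top strand is `(a, b, d)`, with coefficient `-1` in the
boundary. It occurs before the move if `sideT` is right and after it otherwise, with the sign
`posMB`; this gives the factor. By `eq_xor` the other two pairs of opposite faces have the same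
factor. -/
theorem triangleChain_sub (a b d e : X) :
    M.flip.triangleChain R (M.entryColors (pathCube T a b d e))
        (M.flip.midColors (pathCube T a b d e)) (M.exitColors (pathCube T a b d e)) -
      M.triangleChain R (M.entryColors (pathCube T a b d e)) (M.midColors (pathCube T a b d e))
        (M.exitColors (pathCube T a b d e)) =
      (if M.posMB = M.sideT then (-1 : R) else 1) •
        boundary R T 2 (Finsupp.single ![a, b, d, e] 1) := by
  obtain ⟨j₂, j₃, k₁, k₂, k₃⟩ := M.eq_xor
  rw [boundary_two_single]
  simp only [triangleChain, midColors, entryColors, exitColors, flip, j₂, j₃, k₁, k₂,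
    Matrix.cons_val]
  generalize M.posMB = p, M.sideB = b, M.sideM = m, M.sideT = t at *
  cases b <;> cases m <;> cases t <;> cases p <;>
    simp [crossingTerm, pathCube] <;> abel

end TripleData

end TernKnot

namespace TernKnot

/-! ### Colored Gauss codes -/

section Passages

variable {X : Type*} {T : X → X → X → X}

/-- A letter with the colors on both sides of the gaps before and after it. -/
abbrev Passage (X : Type*) : Type _ := Letter × (Bool → X) × (Bool → X)

/-- The passages of a code whose first gap has number `n`, for the colors `f` of the gaps. -/
def passages (f : ℕ → Bool → X) : ℕ → List Letter → List (Passage X)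
  | _, [] => []
  | n, a :: w => (a, f n, f (n + 1)) :: passages f (n + 1) w

theorem passages_append (f : ℕ → Bool → X) (n : ℕ) (x y : List Letter) :
    passages f n (x ++ y) = passages f n x ++ passages f (n + x.length) y := by
  induction x generalizing n with
  | nil => rfl
  | cons a x ih => simp [passages, ih, Nat.add_assoc, Nat.add_comm 1]

theorem passages_congr {f g : ℕ → Bool → X} {n m : ℕ} {w : List Letter}
    (h : ∀ i ≤ w.length, f (n + i) = g (m + i)) : passages f n w = passages g m w := by
  induction w generalizing n m with
  | nil => rfl
  | cons a w ih =>
    have h₀ := h 0 (Nat.zero_le _)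
    have h₁ := h 1 (by simp)
    simp only [Nat.add_zero] at h₀
    rw [passages, passages, h₀, h₁, ih]
    intro i hi
    have := h (i + 1) (by simpa using hi)
    rwa [Nat.add_comm i 1, ← Nat.add_assoc, ← Nat.add_assoc] at this

theorem map_fst_passages (f : ℕ → Bool → X) (n : ℕ) (w : List Letter) :
    (passages f n w).map Prod.fst = w := by
  induction w generalizing n with
  | nil => rfl
  | cons a w ih => simp [passages, ih]

theorem mem_passages {f : ℕ → Bool → X} {n : ℕ} {w : List Letter} {P : Passage X} :
    P ∈ passages f n w ↔ ∃ i, w[i]? = some P.1 ∧ P.2.1 = f (n + i) ∧ P.2.2 = f (n + i + 1) := by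
  induction w generalizing n with
  | nil => simp [passages]
  | cons a w ih =>
    rw [passages, List.mem_cons, ih]
    constructor
    · rintro (rfl | ⟨i, h₁, h₂, h₃⟩)
      · exact ⟨0, rfl, rfl, rfl⟩
      · exact ⟨i + 1, by simpa using h₁, by rw [h₂]; congr 1; omega, by rw [h₃]; congr 1; omega⟩
    · rintro ⟨_ | i, h₁, h₂, h₃⟩
      · left
        ext1
        · simpa using h₁.symm
        · exact Prod.ext h₂ h₃
      · exact .inr ⟨i, by simpa using h₁, by rw [h₂]; congr 1; omega, by rw [h₃]; congr 1; omega⟩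

/-- At every crossing, the colors of the passages fit together. -/
def Compat (T : X → X → X → X) (A : List (Passage X)) : Prop :=
  ∀ k p u₀ u₁ o₀ o₁, (⟨k, false, p⟩, u₀, u₁) ∈ A → (⟨k, true, p⟩, o₀, o₁) ∈ A →
    Crossing T p u₀ u₁ o₀ o₁

theorem Compat.of_subset {A B : List (Passage X)} (h : Compat T B) (hAB : A ⊆ B) : Compat T A :=
  fun k p _ _ _ _ hu ho => h k p _ _ _ _ (hAB hu) (hAB ho)

theorem compat_perm {A B : List (Passage X)} (h : A.Perm B) : Compat T A ↔ Compat T B :=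
  ⟨fun H => H.of_subset h.symm.subset, fun H => H.of_subset h.subset⟩

/-- The letters of a code are distinct passages of crossings. -/
abbrev NodupKeys (w : List Letter) : Prop := (w.map fun a => (a.label, a.isOver)).Nodup

theorem NodupKeys.perm {v w : List Letter} (h : NodupKeys v) (hp : v.Perm w) : NodupKeys w :=
  ((hp.map _).nodup_iff).1 h

/-- A label common to both parts would come with both of its passages in `w`, and one of them would
repeat the passage in `v`. -/
theorem NodupKeys.label_ne {v w : List Letter} (h : NodupKeys (v ++ w))
    (hw : ∀ a ∈ w, ∃ b ∈ w, b.label = a.label ∧ b.isOver = !a.isOver) {a b : Letter} (ha : a ∈ v)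
    (hb : b ∈ w) : a.label ≠ b.label := by
  intro hab
  rw [NodupKeys, List.map_append, List.nodup_append] at h
  obtain ⟨b', hb', h₁, h₂⟩ := hw b hb
  by_cases ho : a.isOver = b.isOver
  · exact h.2.2 _ (List.mem_map_of_mem ha) _ (List.mem_map_of_mem hb) (Prod.ext hab ho)
  · refine h.2.2 _ (List.mem_map_of_mem ha) _ (List.mem_map_of_mem hb') (Prod.ext ?_ ?_)
    · exact hab.trans h₁.symm
    · rw [h₂]; exact Bool.eq_not_of_ne ho

/-- If a part of a code consists of all passages of some crossings, then the conditions at these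
crossings can be separated from the others. -/
theorem compat_append {A B : List (Passage X)}
    (h : NodupKeys (A.map Prod.fst ++ B.map Prod.fst))
    (hB : ∀ a ∈ B.map Prod.fst, ∃ b ∈ B.map Prod.fst, b.label = a.label ∧ b.isOver = !a.isOver) :
    Compat T (A ++ B) ↔ Compat T A ∧ Compat T B := by
  refine ⟨fun H => ⟨H.of_subset (List.subset_append_left _ _),
    H.of_subset (List.subset_append_right _ _)⟩, fun ⟨H₁, H₂⟩ k p u₀ u₁ o₀ o₁ hu ho => ?_⟩
  rw [List.mem_append] at hu ho
  rcases hu with hu | hu <;> rcases ho with ho | ho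
  · exact H₁ _ _ _ _ _ _ hu ho
  · exact (h.label_ne hB (List.mem_map_of_mem hu) (List.mem_map_of_mem ho) rfl).elim
  · exact (h.label_ne hB (List.mem_map_of_mem ho) (List.mem_map_of_mem hu) rfl).elim
  · exact H₂ _ _ _ _ _ _ hu ho

/-- A coloring of a code, in terms of the colors `f g s` on the side `s` of the gap `g`. -/
def IsColoring (T : X → X → X → X) (w : List Letter) (f : ℕ → Bool → X) : Prop :=
  f w.length = f 0 ∧ Compat T (passages f 0 w)

/-- The contribution of a passage to the chain of a diagram. -/
noncomputable def passageTerm (R : Type*) [CommRing R] (P : Passage X) : Chain R X 3 :=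
  if P.1.isOver then 0 else crossingTerm R P.1.isPos P.2.1 P.2.2

/-- The chain of a colored code. -/
noncomputable def passagesChain (R : Type*) [CommRing R] (A : List (Passage X)) : Chain R X 3 :=
  (A.map (passageTerm R)).sum

theorem passagesChain_append (R : Type*) [CommRing R] (A B : List (Passage X)) :
    passagesChain R (A ++ B) = passagesChain R A + passagesChain R B := by
  simp [passagesChain]

theorem passagesChain_perm (R : Type*) [CommRing R] {A B : List (Passage X)} (h : A.Perm B) :
    passagesChain R A = passagesChain R B :=
  (h.map _).sum_eq

end Passages

/-! ### Colorings of diagrams -/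

section Diagram

variable {X : Type*} {T : X → X → X → X} {D : KnotDiagram}

/-- The colors on both sides of the gaps of a colored diagram. -/
def Coloring.gapColor (c : Coloring T D) (g : ℕ) (s : Bool) : X := c.color (region D.code g s)

theorem Coloring.gapColor_injective {c c' : Coloring T D}
    (h : ∀ g ≤ D.code.length, c.gapColor g = c'.gapColor g) : c = c' := by
  ext r
  obtain ⟨⟨g, s⟩, rfl⟩ := Quot.exists_rep r
  have := congrFun (h g (Nat.lt_succ_iff.1 g.2)) s
  simpa [gapColor, region, side, Fin.ofNat_val_eq_self] using this

theorem Glue.region_eq {w : List Letter} {g g' : ℕ} {s s' : Bool}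
    (h : Glue w (side w g s) (side w g' s')) : region w g s = region w g' s' :=
  Quot.sound h

theorem Coloring.isColoring (c : Coloring T D) : IsColoring T D.code c.gapColor := by
  refine ⟨funext fun s => congrArg c.color (Glue.base s).region_eq, ?_⟩
  intro k p u₀ u₁ o₀ o₁ hu ho
  obtain ⟨i, hi, rfl, rfl⟩ := mem_passages.1 hu
  obtain ⟨j, hj, rfl, rfl⟩ := mem_passages.1 ho
  simp only [Nat.zero_add] at *
  have key : ∀ s t, c.gapColor (overArm p j t) s = c.color (quadrant D.code p i s t) :=
    fun s t => congrArg c.color (Glue.corner hi hj s t).region_eq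
  refine ⟨fun s t => c.color (quadrant D.code p i s t), c.rule i k p hi, ?_, ?_, ?_, ?_⟩ <;>
    funext s
  · cases p <;> rfl
  · cases p <;> rfl
  · simpa [overArm] using key s p
  · simpa [overArm] using key s (!p)

theorem IsColoring.crossing {f : ℕ → Bool → X} {w : List Letter} (h : IsColoring T w f)
    {i j k : ℕ} {p : Bool} (hi : w[i]? = some ⟨k, false, p⟩) (hj : w[j]? = some ⟨k, true, p⟩) :
    Crossing T p (f i) (f (i + 1)) (f j) (f (j + 1)) :=
  h.2 k p _ _ _ _ (mem_passages.2 ⟨i, hi, by simp⟩) (mem_passages.2 ⟨j, hj, by simp⟩)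

theorem exists_coloring {f : ℕ → Bool → X} (h : IsColoring T D.code f) :
    ∃ c : Coloring T D, ∀ g ≤ D.code.length, c.gapColor g = f g := by
  have hv : ∀ g ≤ D.code.length, (Fin.ofNat (D.code.length + 1) g : ℕ) = g := fun g hg =>
    Nat.mod_eq_of_lt (Nat.lt_succ_of_le hg)
  have hlt : ∀ {i : ℕ} {a : Letter}, D.code[i]? = some a → i + 1 ≤ D.code.length := fun hi =>
    (List.getElem?_eq_some_iff.1 hi).1
  have hu : ∀ {i : ℕ} {a : Letter} (p s : Bool), D.code[i]? = some a →
      underArm p i s ≤ D.code.length := fun p s hi => by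
    have := hlt hi
    unfold underArm; split <;> omega
  have ho : ∀ {i : ℕ} {a : Letter} (p s : Bool), D.code[i]? = some a →
      overArm p i s ≤ D.code.length := fun p s hi => by
    have := hlt hi
    unfold overArm; split <;> omega
  -- The compatibility at crossings and the equality of the end gaps are just what makes `f`
  -- constant on glued sides. Since `Fin.ofNat` reduces modulo the number of gaps, the bounds above
  -- are needed to read off `f`.
  let col : Region D.code → X := Quot.lift (fun x => f x.1 x.2) (by
    rintro _ _ (⟨s⟩ | ⟨hi, hj, s, t⟩)
    · simp only [side, hv _ le_rfl, hv _ (Nat.zero_le _), h.1]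
    · simp only [side, hv _ (hu _ _ hi), hv _ (ho _ _ hj)]
      obtain ⟨q, -, h₀, h₁, h₂, h₃⟩ := h.crossing hi hj
      simp only [funext_iff] at h₀ h₁ h₂ h₃
      rename_i p
      cases p <;> cases s <;> cases t <;> simp [overArm, underArm, *])
  have hcol : ∀ g s, g ≤ D.code.length → col (region D.code g s) = f g s := fun g s hg =>
    congrArg (fun n => f n s) (hv g hg)
  refine ⟨⟨col, fun i k p hi s t => ?_⟩, fun g hg => funext fun s => hcol g s hg⟩
  obtain ⟨j, hj⟩ := List.getElem?_of_mem (D.paired _ (List.mem_of_getElem? hi))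
  obtain ⟨q, hq, h₀, h₁, -, -⟩ := h.crossing hi hj
  have hquad : ∀ s t, col (quadrant D.code p i s t) = q s t := by
    intro s t
    rw [quadrant, hcol _ _ (hu _ _ hi)]
    simp only [funext_iff] at h₀ h₁
    cases p <;> cases s <;> simp [underArm, *]
  simp only [hquad]
  exact hq s t

theorem knotChain_eq (R : Type*) [CommRing R] (c : Coloring T D) :
    knotChain R c = passagesChain R (passages c.gapColor 0 D.code) := by
  have key : ∀ (f : ℕ → Bool → X) (w : List Letter) (n : ℕ), passagesChain R (passages f n w) =
      ∑ i ∈ Finset.range w.length,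
        (w[i]?.map fun a => passageTerm R (a, f (n + i), f (n + i + 1))).getD 0 := by
    intro f w
    induction w with
    | nil => intro n; rfl
    | cons a w ih =>
      intro n
      rw [List.length_cons, Finset.sum_range_succ', passages, passagesChain, List.map_cons,
        List.sum_cons, add_comm]
      congr 1
      refine (ih (n + 1)).trans (Finset.sum_congr rfl fun i _ => ?_)
      rw [List.getElem?_cons_succ, Nat.add_right_comm n 1 i, Nat.add_assoc n i 1]
  rw [key, knotChain]
  refine Finset.sum_congr rfl fun i _ => ?_
  rw [ascendingPath]
  rcases D.code[i]? with _ | ⟨k, _ | _, p⟩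
  · rfl
  · cases p <;> simp [passageTerm, crossingTerm, quadrant, underArm, Coloring.gapColor]
  · rfl

end Diagram

end TernKnot

namespace TernKnot

/-! ### The chain of a colored diagram is a cycle -/

section Cycle

variable {X : Type*} {T : X → X → X → X} (R : Type*) [CommRing R]

/-- The boundary of a chain of passages, if every passage has a partner. -/
theorem Compat.boundary_passagesChain : ∀ {A : List (Passage X)}, Compat T A →
    NodupKeys (A.map Prod.fst) →
    (∀ a ∈ A.map Prod.fst, (⟨a.label, !a.isOver, a.isPos⟩ : Letter) ∈ A.map Prod.fst) →
    boundary R T 1 (passagesChain R A) =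
      (A.map fun P => gapChain R P.2.1 - gapChain R P.2.2).sum
  | [], _, _, _ => by simp [passagesChain]
  | P :: A, hc, hn, hp => by
    -- The boundary is known only for a whole crossing, so the induction removes a passage together
    -- with its partner `Q`.
    have hP := hp P.1 (by simp)
    rw [List.map_cons, List.mem_cons] at hP
    obtain ⟨Q, hQ, hQP⟩ := List.mem_map.1 (hP.resolve_left fun h => by
      simpa using congrArg Letter.isOver h)
    obtain ⟨B, hB⟩ : ∃ B, (P :: A).Perm (P :: Q :: B) := by
      obtain ⟨s, t, rfl⟩ := List.append_of_mem hQ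
      exact ⟨s ++ t, List.perm_middle.cons P⟩
    have hlen : B.length < (P :: A).length := by
      rw [hB.length_eq]; simp
    have hn' := NodupKeys.perm hn (hB.map Prod.fst)
    have hne : ∀ b ∈ B.map Prod.fst, b.label ≠ P.1.label := by
      intro b hb hl
      simp only [NodupKeys, List.map_cons, List.nodup_cons, List.mem_cons, not_or] at hn'
      have h₁ : b.isOver ≠ P.1.isOver := fun h =>
        hn'.1.2 (List.mem_map.2 ⟨b, hb, Prod.ext hl h⟩)
      exact hn'.2.1 (List.mem_map.2 ⟨b, hb, by rw [hQP, hl, Bool.eq_not_of_ne h₁]⟩)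
    have ih := Compat.boundary_passagesChain (A := B)
      (hc.of_subset fun x hx => hB.symm.subset (by simp [hx]))
      (by
        simp only [NodupKeys, List.map_cons, List.nodup_cons] at hn'
        exact hn'.2.2)
      (by
        intro b hb
        have := (hB.map Prod.fst).subset (hp b ((hB.map Prod.fst).symm.subset (by simp [hb])))
        rw [List.map_cons, List.map_cons, List.mem_cons, List.mem_cons] at this
        rcases this with h | h | h
        · have hl := congrArg Letter.label h
          exact (hne b hb hl).elim
        · rw [hQP] at h
          have hl := congrArg Letter.label h
          exact (hne b hb hl).elim
        · exact h)
    rw [passagesChain_perm R hB, (hB.map _).sum_eq]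
    have hPQ : boundary R T 1 (passageTerm R P + passageTerm R Q) =
        (gapChain R P.2.1 - gapChain R P.2.2) + (gapChain R Q.2.1 - gapChain R Q.2.2) := by
      have hP' : P ∈ P :: A := by simp
      have hQ' : Q ∈ P :: A := by simp [hQ]
      obtain ⟨⟨k, o, p⟩, i, j⟩ := P
      obtain ⟨_, i', j'⟩ := Q
      dsimp only at hQP
      subst hQP
      cases o
      · have := (hc k p i j i' j' hP' hQ').boundary_crossingTerm R
        simpa [passageTerm] using this
      · have := (hc k p i' j' i j hQ' hP').boundary_crossingTerm R
        simpa [passageTerm, add_comm] using this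
    have : passagesChain R (P :: Q :: B) =
        (passageTerm R P + passageTerm R Q) + passagesChain R B := by
      simp [passagesChain, add_assoc]
    rw [this, map_add, hPQ, ih, List.map_cons, List.map_cons, List.sum_cons, List.sum_cons,
      add_assoc]
  termination_by A => A.length
  decreasing_by exact hlen

theorem sum_gapChain_passages (f : ℕ → Bool → X) (n : ℕ) (w : List Letter) :
    ((passages f n w).map fun P => gapChain R P.2.1 - gapChain R P.2.2).sum =
      gapChain R (f n) - gapChain R (f (n + w.length)) := by
  induction w generalizing n with
  | nil => simp [passages]
  | cons a w ih =>
    simp only [passages, List.map_cons, List.sum_cons, ih, List.length_cons]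
    rw [sub_add_sub_cancel, Nat.add_assoc, Nat.add_comm 1]

/-- Along the code the sum of incoming minus outgoing gaps telescopes to the difference of the first
and the last gap, which are parts of one arc. -/
theorem boundary_knotChain {D : KnotDiagram} (c : Coloring T D) :
    boundary R T 1 (knotChain R c) = 0 := by
  obtain ⟨h₀, hc⟩ := c.isColoring
  rw [knotChain_eq, hc.boundary_passagesChain R, sum_gapChain_passages, Nat.zero_add, h₀, sub_self]
  · rw [map_fst_passages]; exact D.nodup
  · rw [map_fst_passages]; exact D.paired

theorem normKnotChain_mem {D : KnotDiagram} (c : Coloring T D) :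
    normKnotChain R c ∈ normCycles R T 1 :=
  Submodule.mem_map_of_mem (by
    rw [Submodule.mem_comap, boundary_knotChain]; exact Submodule.zero_mem _)

end Cycle

end TernKnot

namespace TernKnot

/-! ### Transport of colorings along moves -/

section Transport

variable {X : Type*} {T : X → X → X → X}

/-- Two colorings of the gaps of codes agree along a relation of gaps. -/
def GapsAgree (w : List Letter) (r : ℕ → ℕ → Prop) (f f' : ℕ → Bool → X) : Prop :=
  ∀ g g', g ≤ w.length → r g g' → f g = f' g'

/-- Colorings carry over in exactly one way from `w` to `w'`, and the homology class of the chain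
does not change. -/
structure Transport (T : X → X → X → X) (R : Type*) [CommRing R] (w w' : List Letter)
    (r : ℕ → ℕ → Prop) : Prop where
  le_length : ∀ g g', g ≤ w.length → r g g' → g' ≤ w'.length
  exists_right : ∀ f, IsColoring T w f →
    (∀ g g' s s', g ≤ w.length → g' ≤ w.length → region w g s = region w g' s' →
      f g s = f g' s') →
    ∃ f', IsColoring T w' f' ∧ GapsAgree w r f f'
  unique_right : ∀ f f₁ f₂, IsColoring T w' f₁ → IsColoring T w' f₂ → GapsAgree w r f f₁ →
    GapsAgree w r f f₂ → ∀ g ≤ w'.length, f₁ g = f₂ g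
  exists_left : ∀ f', IsColoring T w' f' → ∃ f, IsColoring T w f ∧ GapsAgree w r f f'
  unique_left : ∀ f' f₁ f₂, IsColoring T w f₁ → IsColoring T w f₂ → GapsAgree w r f₁ f' →
    GapsAgree w r f₂ f' → ∀ g ≤ w.length, f₁ g = f₂ g
  chain_sub_mem : ∀ f f', IsColoring T w f → IsColoring T w' f' → GapsAgree w r f f' →
    passagesChain R (passages f 0 w) - passagesChain R (passages f' 0 w') ∈
      degenerate R X 3 ⊔ LinearMap.range (boundary R T 2)

theorem agree_iff {D D' : KnotDiagram} {r : ℕ → ℕ → Prop} {c : Coloring T D} {c' : Coloring T D'} :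
    Agree r c c' ↔ GapsAgree D.code r c.gapColor c'.gapColor :=
  ⟨fun h g g' hg hr => funext fun s => h g g' hg hr s,
    fun h g g' hg hr s => congrFun (h g g' hg hr) s⟩

variable {R : Type*} [CommRing R] {D D' : KnotDiagram} {r : ℕ → ℕ → Prop}

theorem Transport.existsUnique_right (h : Transport T R D.code D'.code r) (c : Coloring T D) :
    ∃! c' : Coloring T D', Agree r c c' := by
  obtain ⟨f', hf', ha⟩ := h.exists_right _ c.isColoring
    fun g g' s s' _ _ e => congrArg c.color e
  obtain ⟨c', hc'⟩ := exists_coloring hf'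
  have hcc : Agree r c c' := agree_iff.2 fun g g' hg hr =>
    (ha g g' hg hr).trans (hc' g' (h.le_length g g' hg hr)).symm
  exact ⟨c', hcc, fun c'' h'' => Coloring.gapColor_injective
    (h.unique_right _ _ _ c''.isColoring c'.isColoring (agree_iff.1 h'') (agree_iff.1 hcc))⟩

theorem Transport.existsUnique_left (h : Transport T R D.code D'.code r) (c' : Coloring T D') :
    ∃! c : Coloring T D, Agree r c c' := by
  obtain ⟨f, hf, ha⟩ := h.exists_left _ c'.isColoring
  obtain ⟨c, hc⟩ := exists_coloring hf
  have hcc : Agree r c c' := agree_iff.2 fun g g' hg hr => (hc g hg).trans (ha g g' hg hr)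
  exact ⟨c, hcc, fun c'' h'' => Coloring.gapColor_injective
    (h.unique_left _ _ _ c''.isColoring c.isColoring (agree_iff.1 h'') (agree_iff.1 hcc))⟩

theorem Transport.normKnotChain_sub_mem (h : Transport T R D.code D'.code r) {c : Coloring T D}
    {c' : Coloring T D'} (hc : Agree r c c') :
    normKnotChain R c - normKnotChain R c' ∈ normBoundaries R T 1 := by
  have := h.chain_sub_mem _ _ c.isColoring c'.isColoring (agree_iff.1 hc)
  rw [← knotChain_eq, ← knotChain_eq] at this
  obtain ⟨y, hy, z, hz, e⟩ := Submodule.mem_sup.1 this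
  refine ⟨z, hz, ?_⟩
  rw [normKnotChain, normKnotChain, ← map_sub, ← e, map_add, Submodule.mkQ_apply _ y,
    (Submodule.Quotient.mk_eq_zero _).2 hy, zero_add]

end Transport

/-! ### Base points, names of crossings, and the first two moves -/

section Moves

variable {X : Type*} {T : X → X → X → X} {R : Type*} [CommRing R]

/-- The passages are only permuted cyclically. The relation sends both end gaps of `x ++ y` to gap
`y.length`, and gap `x.length` to both end gaps of `y ++ x`, so agreement already forces the codes
to close up. -/
theorem transport_rotate (x y : List Letter) :
    Transport T R (x ++ y) (y ++ x) fun g g' =>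
      (g ≤ x.length ∧ g' = g + y.length) ∨ (x.length ≤ g ∧ g' + x.length = g) := by
  have key : ∀ f f' : ℕ → Bool → X, GapsAgree (x ++ y) (fun g g' =>
      (g ≤ x.length ∧ g' = g + y.length) ∨ (x.length ≤ g ∧ g' + x.length = g)) f f' →
      (IsColoring T (x ++ y) f ↔ IsColoring T (y ++ x) f') ∧
      passagesChain R (passages f 0 (x ++ y)) = passagesChain R (passages f' 0 (y ++ x)) := by
    intro f f' h
    have hf : f (x ++ y).length = f 0 := (h _ y.length le_rfl (by simp; omega)).trans
      (h 0 y.length (Nat.zero_le _) (by simp)).symm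
    have hf' : f' (y ++ x).length = f' 0 := (h x.length _ (by simp) (by simp; omega)).symm.trans
      (h x.length 0 (by simp) (by simp))
    have hp : (passages f 0 (x ++ y)).Perm (passages f' 0 (y ++ x)) := by
      rw [passages_append, passages_append,
        passages_congr (f := f) (g := f') (m := 0 + y.length) (w := x),
        passages_congr (f := f) (g := f') (m := 0) (w := y)]
      · exact List.perm_append_comm
      · intro i hi
        exact h _ _ (by simp; omega) (by omega)
      · intro i hi
        exact h _ _ (by simp; omega) (by omega)
    exact ⟨and_congr (iff_of_true hf hf') (compat_perm hp), passagesChain_perm R hp⟩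
  refine ⟨?_, ?_, ?_, ?_, ?_, ?_⟩
  · intro g g' hg h
    simp only [List.length_append] at hg ⊢
    omega
  · intro f hf _
    have h₀ := hf.1
    simp only [List.length_append] at h₀
    have ha : GapsAgree (x ++ y) (fun g g' =>
      (g ≤ x.length ∧ g' = g + y.length) ∨ (x.length ≤ g ∧ g' + x.length = g)) f
        fun g' => if g' ≤ y.length then f (g' + x.length) else f (g' - y.length) := by
      rintro g g' hg (⟨h₁, rfl⟩ | ⟨h₁, rfl⟩)
      · rcases Nat.eq_zero_or_pos g with rfl | hpos
        · simp [← h₀, add_comm]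
        · dsimp only
          rw [if_neg (by omega), Nat.add_sub_cancel]
      · simp only [List.length_append] at hg
        dsimp only
        rw [if_pos (by omega)]
    exact ⟨_, ((key _ _ ha).1.1 hf), ha⟩
  · intro f f₁ f₂ _ _ h₁ h₂ g hg
    simp only [List.length_append] at hg
    by_cases hy : g ≤ y.length
    · exact (h₁ (g + x.length) g (by simp; omega) (by omega)).symm.trans
        (h₂ (g + x.length) g (by simp; omega) (by omega))
    · exact (h₁ (g - y.length) g (by simp; omega) (by omega)).symm.trans
        (h₂ (g - y.length) g (by simp; omega) (by omega))
  · intro f' hf'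
    have h₀ := hf'.1
    simp only [List.length_append] at h₀
    have ha : GapsAgree (x ++ y) (fun g g' =>
      (g ≤ x.length ∧ g' = g + y.length) ∨ (x.length ≤ g ∧ g' + x.length = g))
        (fun g => if g ≤ x.length then f' (g + y.length) else f' (g - x.length)) f' := by
      rintro g g' hg (⟨h₁, rfl⟩ | ⟨h₁, rfl⟩)
      · dsimp only
        rw [if_pos h₁]
      · rcases Nat.eq_zero_or_pos g' with rfl | hpos
        · simp [← h₀, add_comm]
        · dsimp only
          rw [if_neg (by omega), Nat.add_sub_cancel]
    exact ⟨_, ((key _ _ ha).1.2 hf'), ha⟩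
  · intro f' f₁ f₂ _ _ h₁ h₂ g hg
    simp only [List.length_append] at hg
    by_cases hx : g ≤ x.length
    · exact (h₁ g (g + y.length) (by simp; omega) (by omega)).trans
        (h₂ g (g + y.length) (by simp; omega) (by omega)).symm
    · exact (h₁ g (g - x.length) (by simp; omega) (by omega)).trans
        (h₂ g (g - x.length) (by simp; omega) (by omega)).symm
  · intro f f' _ _ h
    rw [(key f f' h).2, sub_self]
    exact Submodule.zero_mem _

theorem transport_relabel (w : List Letter) (σ : Equiv.Perm ℕ) :
    Transport T R w (w.map fun a => ⟨σ a.label, a.isOver, a.isPos⟩) fun g g' => g' = g := by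
  have hpass : ∀ (f : ℕ → Bool → X) (n : ℕ) (w : List Letter),
      passages f n (w.map fun a => ⟨σ a.label, a.isOver, a.isPos⟩) =
        (passages f n w).map fun P => (⟨σ P.1.label, P.1.isOver, P.1.isPos⟩, P.2) := by
    intro f n w
    induction w generalizing n with
    | nil => rfl
    | cons a w ih => simp [passages, ih]
  have hcol : ∀ f : ℕ → Bool → X,
      IsColoring T (w.map fun a => ⟨σ a.label, a.isOver, a.isPos⟩) f ↔ IsColoring T w f := by
    intro f
    simp only [IsColoring, List.length_map, hpass]
    refine and_congr_right fun _ => ⟨fun h k p u₀ u₁ o₀ o₁ hu ho => ?_,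
      fun h k p u₀ u₁ o₀ o₁ hu ho => ?_⟩
    · exact h (σ k) p u₀ u₁ o₀ o₁ (List.mem_map.2 ⟨_, hu, rfl⟩) (List.mem_map.2 ⟨_, ho, rfl⟩)
    · obtain ⟨⟨⟨k₁, i, j⟩, P⟩, hP, e⟩ := List.mem_map.1 hu
      obtain ⟨⟨⟨k₂, i', j'⟩, Q⟩, hQ, e'⟩ := List.mem_map.1 ho
      simp only [Prod.mk.injEq, Letter.mk.injEq] at e e'
      obtain ⟨⟨rfl, rfl, rfl⟩, rfl⟩ := e
      obtain ⟨⟨hk, rfl, rfl⟩, rfl⟩ := e'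
      obtain rfl := σ.injective hk
      exact h _ _ _ _ _ _ hP hQ
  have hcongr : ∀ f f' : ℕ → Bool → X, GapsAgree w (fun g g' => g' = g) f f' →
      passages f 0 w = passages f' 0 w :=
    fun f f' h => passages_congr fun i hi => h _ _ (by omega) rfl
  refine ⟨by rintro g _ h rfl; simpa using h,
    fun f hf _ => ⟨f, (hcol f).2 hf, by rintro g _ - rfl; rfl⟩,
    fun f f₁ f₂ _ _ h₁ h₂ g hg => ?_, fun f hf => ⟨f, (hcol f).1 hf, by rintro g _ - rfl; rfl⟩,
    fun f f₁ f₂ _ _ h₁ h₂ g hg => (h₁ g g hg rfl).trans (h₂ g g hg rfl).symm, fun f f' _ _ h => ?_⟩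
  · rw [List.length_map] at hg
    exact (h₁ g g hg rfl).symm.trans (h₂ g g hg rfl)
  · have : passagesChain R (passages f 0 w) = passagesChain R (passages f' 0
        (w.map fun a => ⟨σ a.label, a.isOver, a.isPos⟩)) := by
      rw [hpass, hcongr f f' h, passagesChain, passagesChain, List.map_map]
      rfl
    rw [this, sub_self]
    exact Submodule.zero_mem _

end Moves

end TernKnot

namespace TernKnot

/-! ### The first move. -/

section Kink

variable {X : Type*} {T : X → X → X → X} {R : Type*} [CommRing R]

theorem compat_kinkPassages {k : ℕ} {o p : Bool} {e₀ e₁ e₂ : Bool → X} :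
    Compat T [(⟨k, o, p⟩, e₀, e₁), (⟨k, !o, p⟩, e₁, e₂)] ↔ Kink T o p e₀ e₁ e₂ := by
  constructor
  · intro h
    have h₁ := h k p
    cases o <;> simp [Kink] at h₁ ⊢ <;> exact h₁ _ _ _ _ rfl rfl rfl rfl
  · intro h k' p' u₀ u₁ o₀ o₁
    cases o <;> simp [Kink] at h ⊢ <;> grind

theorem transport_one (hT : IsTern T) (x y : List Letter) (k : ℕ) (o p : Bool)
    (hn : NodupKeys (x ++ [⟨k, o, p⟩, ⟨k, !o, p⟩] ++ y)) :
    Transport T R (x ++ y) (x ++ [⟨k, o, p⟩, ⟨k, !o, p⟩] ++ y) fun g g' =>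
        (g ≤ x.length ∧ g' = g) ∨ (x.length ≤ g ∧ g' = g + 2) := by
  set n := x.length with hx
  set w' := x ++ [⟨k, o, p⟩, ⟨k, !o, p⟩] ++ y with hw'
  set r : ℕ → ℕ → Prop := fun g g' => (g ≤ n ∧ g' = g) ∨ (n ≤ g ∧ g' = g + 2) with hr
  have hlen : (x ++ y).length = n + y.length := by simp [hx]
  have hlen' : w'.length = n + 2 + y.length := by simp [hw', hx]; omega
  have hperm : ∀ f f' : ℕ → Bool → X, GapsAgree (x ++ y) r f f' →
      (passages f' 0 w').Perm (passages f 0 (x ++ y) ++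
        [(⟨k, o, p⟩, f' n, f' (n + 1)), (⟨k, !o, p⟩, f' (n + 1), f' (n + 2))]) := by
    intro f f' h
    rw [hw', passages_append, passages_append, passages_append,
      passages_congr (f := f) (g := f') (n := 0) (m := 0) (w := x),
      passages_congr (f := f) (g := f') (m := n + 2) (w := y)]
    · simp only [passages, Nat.zero_add, List.length_append, List.length_cons, List.length_nil,
        ← hx, List.append_assoc]
      exact List.perm_append_comm.append_left _
    · intro i hi
      exact h _ _ (by omega) (.inr ⟨by omega, by omega⟩)
    · intro i hi
      exact h _ _ (by omega) (.inl ⟨by omega, rfl⟩)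
  have hsplit : ∀ f' : ℕ → Bool → X, ∀ A, (passages f' 0 w').Perm (A ++
        [(⟨k, o, p⟩, f' n, f' (n + 1)), (⟨k, !o, p⟩, f' (n + 1), f' (n + 2))]) →
      (Compat T (passages f' 0 w') ↔
        Compat T A ∧ Kink T o p (f' n) (f' (n + 1)) (f' (n + 2))) := by
    intro f' A h
    rw [compat_perm h, compat_append]
    · exact and_congr_right fun _ => compat_kinkPassages
    · have := h.map Prod.fst
      rw [map_fst_passages, List.map_append] at this
      exact hn.perm this
    · simp
  have hcol : ∀ f f' : ℕ → Bool → X, GapsAgree (x ++ y) r f f' →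
      (IsColoring T w' f' ↔ IsColoring T (x ++ y) f ∧
        Kink T o p (f' n) (f' (n + 1)) (f' (n + 2))) := by
    intro f f' h
    rw [IsColoring, IsColoring, hsplit _ _ (hperm f f' h), and_assoc,
      h (x ++ y).length w'.length le_rfl (.inr ⟨by omega, by omega⟩),
      h 0 0 (Nat.zero_le _) (.inl ⟨Nat.zero_le _, rfl⟩)]
  -- No coloring of `x ++ y` is available yet, so the outer passages are taken from `f'` itself.
  have hkink : ∀ f', IsColoring T w' f' → Kink T o p (f' n) (f' (n + 1)) (f' (n + 2)) := by
    intro f' hf'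
    refine ((hsplit f' (passages f' 0 x ++ passages f' (n + 2) y) ?_).1 hf'.2).2
    rw [hw', passages_append, passages_append]
    simp only [passages, Nat.zero_add, List.length_append, List.length_cons, List.length_nil,
        ← hx, List.append_assoc]
    exact List.perm_append_comm.append_left _
  refine ⟨?_, ?_, ?_, ?_, ?_, ?_⟩
  · rintro g g' hg (⟨h₁, rfl⟩ | ⟨h₁, rfl⟩) <;> omega
  · intro f hf _
    have ha : GapsAgree (x ++ y) r f fun g => if g ≤ n then f g else
        if g = n + 1 then fun s => f n (!s) else f (g - 2) := by
      rintro g g' hg (⟨h₁, rfl⟩ | ⟨h₁, rfl⟩)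
      · dsimp only
        rw [if_pos h₁]
      · dsimp only
        rw [if_neg (by omega), if_neg (by omega), Nat.add_sub_cancel]
    refine ⟨_, (hcol _ _ ha).2 ⟨hf, hT.kink_iff.2 ?_⟩, ha⟩
    simp
  · intro f f₁ f₂ hf₁ hf₂ h₁ h₂ g hg
    have e₁ := (hT.kink_iff.1 (hkink f₁ hf₁)).2
    have e₂ := (hT.kink_iff.1 (hkink f₂ hf₂)).2
    have e : ∀ g₀ g', g₀ ≤ (x ++ y).length → r g₀ g' → f₁ g' = f₂ g' := fun g₀ g' hg hr =>
      (h₁ g₀ g' hg hr).symm.trans (h₂ g₀ g' hg hr)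
    rcases lt_trichotomy g (n + 1) with hg' | rfl | hg'
    · exact e g g (by omega) (.inl ⟨by omega, rfl⟩)
    · rw [e₁, e₂, e n n (by omega) (.inl ⟨le_rfl, rfl⟩)]
    · exact e (g - 2) g (by omega) (.inr ⟨by omega, by omega⟩)
  · intro f' hf'
    -- Gap `n` of `x ++ y` is related to both ends of the kink; they carry the same colors.
    have e := (hT.kink_iff.1 (hkink f' hf')).1
    have ha : GapsAgree (x ++ y) r (fun g => if g ≤ n then f' g else f' (g + 2)) f' := by
      rintro g g' hg (⟨h₁, rfl⟩ | ⟨h₁, rfl⟩)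
      · dsimp only
        rw [if_pos h₁]
      · dsimp only
        split
        · rw [show g = n by omega, e]
        · rfl
    exact ⟨_, ((hcol _ _ ha).1 hf').1, ha⟩
  · intro f' f₁ f₂ _ _ h₁ h₂ g hg
    by_cases hgn : g ≤ n
    · exact (h₁ g g hg (.inl ⟨hgn, rfl⟩)).trans (h₂ g g hg (.inl ⟨hgn, rfl⟩)).symm
    · exact (h₁ g _ hg (.inr ⟨by omega, rfl⟩)).trans (h₂ g _ hg (.inr ⟨by omega, rfl⟩)).symm
  · intro f f' _ hf' h
    rw [passagesChain_perm R (hperm f f' h), passagesChain_append, sub_add_cancel_left]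
    refine Submodule.neg_mem _ (Submodule.mem_sup_left ?_)
    have := hT.kink_crossingTerm_mem R (hkink f' hf')
    cases o <;> simpa [passagesChain, passageTerm] using this

end Kink

/-! ### The second move. -/

section Clasp

variable {X : Type*} {T : X → X → X → X} {R : Type*} [CommRing R]

/-- The passages of a second move through its two crossings. -/
def claspPassages (k l : ℕ) (o a b : Bool) (e₀ e₁ e₂ f₀ f₁ f₂ : Bool → X) : List (Passage X) :=
  [(⟨k, o, b == o⟩, e₀, e₁), (⟨l, o, !(b == o)⟩, e₁, e₂)] ++
    if a = b then [(⟨l, !o, !(b == o)⟩, f₀, f₁), (⟨k, !o, b == o⟩, f₁, f₂)]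
    else [(⟨k, !o, b == o⟩, f₀, f₁), (⟨l, !o, !(b == o)⟩, f₁, f₂)]

theorem compat_claspPassages {k l : ℕ} (hkl : k ≠ l) {o a b : Bool}
    {e₀ e₁ e₂ f₀ f₁ f₂ : Bool → X} :
    Compat T (claspPassages k l o a b e₀ e₁ e₂ f₀ f₁ f₂) ↔
      Clasp T o a b e₀ e₁ e₂ f₀ f₁ f₂ := by
  have hlk := hkl.symm
  constructor
  · intro h
    have h₁ := h k (b == o)
    have h₂ := h l (!(b == o))
    cases o <;> cases a <;> cases b <;> simp [claspPassages, Clasp, hkl, hlk] at h₁ h₂ ⊢ <;>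
      exact ⟨h₁ _ _ _ _ rfl rfl rfl rfl, h₂ _ _ _ _ rfl rfl rfl rfl⟩
  · intro h k' p u₀ u₁ o₀ o₁
    cases o <;> cases a <;> cases b <;> simp [claspPassages, Clasp] at h ⊢ <;> grind

theorem passagesChain_claspPassages {k l : ℕ} {o a b : Bool}
    {e₀ e₁ e₂ f₀ f₁ f₂ : Bool → X} (h : Clasp T o a b e₀ e₁ e₂ f₀ f₁ f₂) :
    passagesChain R (claspPassages k l o a b e₀ e₁ e₂ f₀ f₁ f₂) = 0 := by
  have := h.sum_crossingTerm R
  cases o <;> cases a <;> cases b <;>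
    simpa [claspPassages, passagesChain, passageTerm, add_comm] using this

theorem claspPassages_partner (k l : ℕ) (o a b : Bool) (e₀ e₁ e₂ f₀ f₁ f₂ : Bool → X) :
    ∀ c ∈ (claspPassages k l o a b e₀ e₁ e₂ f₀ f₁ f₂).map Prod.fst,
      ∃ d ∈ (claspPassages k l o a b e₀ e₁ e₂ f₀ f₁ f₂).map Prod.fst,
        d.label = c.label ∧ d.isOver = !c.isOver := by
  by_cases h : a = b <;> simp [claspPassages, h]

theorem transport_two (hT : IsTern T) (x y z : List Letter) (k l : ℕ) (o a b : Bool)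
    (hreg : region (x ++ y ++ z) x.length a = region (x ++ y ++ z) (x.length + y.length) b)
    (hn : NodupKeys (x ++ [⟨k, o, b == o⟩, ⟨l, o, !(b == o)⟩] ++ y ++
          (if a = b then [⟨l, !o, !(b == o)⟩, ⟨k, !o, b == o⟩]
            else [⟨k, !o, b == o⟩, ⟨l, !o, !(b == o)⟩]) ++ z)) :
    Transport T R (x ++ y ++ z) (x ++ [⟨k, o, b == o⟩, ⟨l, o, !(b == o)⟩] ++ y ++
          (if a = b then [⟨l, !o, !(b == o)⟩, ⟨k, !o, b == o⟩]
            else [⟨k, !o, b == o⟩, ⟨l, !o, !(b == o)⟩]) ++ z)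
        fun g g' => (g ≤ x.length ∧ g' = g) ∨
          (x.length ≤ g ∧ g ≤ x.length + y.length ∧ g' = g + 2) ∨
          (x.length + y.length ≤ g ∧ g' = g + 4) := by
  set n := x.length with hx
  set m := y.length with hy
  set S : List Letter := if a = b then [⟨l, !o, !(b == o)⟩, ⟨k, !o, b == o⟩]
            else [⟨k, !o, b == o⟩, ⟨l, !o, !(b == o)⟩] with hS
  set w' := x ++ [⟨k, o, b == o⟩, ⟨l, o, !(b == o)⟩] ++ y ++ S ++ z with hw'
  set r : ℕ → ℕ → Prop := fun g g' => (g ≤ n ∧ g' = g) ∨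
    (n ≤ g ∧ g ≤ n + m ∧ g' = g + 2) ∨ (n + m ≤ g ∧ g' = g + 4) with hr
  have hSlen : S.length = 2 := by rw [hS]; split <;> rfl
  have hlen : (x ++ y ++ z).length = n + m + z.length := by simp [hx, hy]; omega
  have hlen' : w'.length = n + m + z.length + 4 := by simp [hw', hx, hy, hSlen]; omega
  set C : (ℕ → Bool → X) → List (Passage X) := fun f' => claspPassages k l o a b (f' n)
    (f' (n + 1)) (f' (n + 2)) (f' (n + m + 2)) (f' (n + m + 3)) (f' (n + m + 4)) with hC
  have hkl : k ≠ l := by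
    rintro rfl
    rw [hw', NodupKeys] at hn
    simp [List.nodup_append] at hn
  have hperm₀ : ∀ f' : ℕ → Bool → X, (passages f' 0 w').Perm (passages f' 0 x ++
      passages f' (n + 2) y ++ passages f' (n + m + 4) z ++ C f') := by
    intro f'
    have hC' : C f' = passages f' n [⟨k, o, b == o⟩, ⟨l, o, !(b == o)⟩] ++
        passages f' (n + m + 2) S := by
      simp only [hC, hS, claspPassages]
      split <;> rfl
    rw [hw', hC', passages_append, passages_append, passages_append, passages_append]
    simp only [List.length_append, List.length_cons, List.length_nil, hSlen, ← hx, ← hy,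
      Nat.zero_add]
    rw [show n + 2 + m = n + m + 2 by omega, show n + m + 2 + 2 = n + m + 4 by omega]
    simp only [← Multiset.coe_eq_coe, ← Multiset.coe_add]
    abel
  have hperm : ∀ f f' : ℕ → Bool → X, GapsAgree (x ++ y ++ z) r f f' →
      (passages f' 0 w').Perm (passages f 0 (x ++ y ++ z) ++ C f') := by
    intro f f' h
    refine (hperm₀ f').trans (List.Perm.of_eq ?_)
    rw [passages_append, passages_append,
      passages_congr (f := f) (g := f') (n := 0) (m := 0) (w := x),
      passages_congr (f := f) (g := f') (m := n + 2) (w := y),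
      passages_congr (f := f) (g := f') (m := n + m + 4) (w := z)]
    · intro i hi
      simp only [List.length_append, ← hx, ← hy]
      exact h _ _ (by omega) (.inr (.inr ⟨by omega, by omega⟩))
    · intro i hi
      exact h _ _ (by omega) (.inr (.inl ⟨by omega, by omega, by omega⟩))
    · intro i hi
      exact h _ _ (by omega) (.inl ⟨by omega, rfl⟩)
  have hsplit : ∀ f' : ℕ → Bool → X, ∀ A, (passages f' 0 w').Perm (A ++ C f') →
      (Compat T (passages f' 0 w') ↔ Compat T A ∧ Clasp T o a b (f' n) (f' (n + 1)) (f' (n + 2))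
        (f' (n + m + 2)) (f' (n + m + 3)) (f' (n + m + 4))) := by
    intro f' A h
    rw [compat_perm h, compat_append]
    · exact and_congr_right fun _ => compat_claspPassages hkl
    · have := h.map Prod.fst
      rw [map_fst_passages, List.map_append] at this
      exact hn.perm this
    · exact claspPassages_partner _ _ _ _ _ _ _ _ _ _ _
  have hcol : ∀ f f' : ℕ → Bool → X, GapsAgree (x ++ y ++ z) r f f' →
      (IsColoring T w' f' ↔ IsColoring T (x ++ y ++ z) f ∧ Clasp T o a b (f' n) (f' (n + 1))
        (f' (n + 2)) (f' (n + m + 2)) (f' (n + m + 3)) (f' (n + m + 4))) := by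
    intro f f' h
    rw [IsColoring, IsColoring, hsplit _ _ (hperm f f' h), and_assoc,
      h (x ++ y ++ z).length w'.length le_rfl (.inr (.inr ⟨by omega, by omega⟩)),
      h 0 0 (Nat.zero_le _) (.inl ⟨Nat.zero_le _, rfl⟩)]
  have hclasp : ∀ f', IsColoring T w' f' → Clasp T o a b (f' n) (f' (n + 1)) (f' (n + 2))
      (f' (n + m + 2)) (f' (n + m + 3)) (f' (n + m + 4)) :=
    fun f' hf' => ((hsplit f' _ (hperm₀ f')).1 hf'.2).2
  refine ⟨?_, ?_, ?_, ?_, ?_, ?_⟩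
  · rintro g g' hg (⟨h₁, rfl⟩ | ⟨h₁, h₂, rfl⟩ | ⟨h₁, rfl⟩) <;> omega
  · intro f hf hregion
    -- The common region bordered by the two gaps provides the equality of colors needed to cross
    -- them.
    obtain ⟨q, hq, he, hf₀⟩ := hT.exists_rule_arm o
      (hregion n (n + m) a b (by omega) (by omega) hreg)
    have ha : GapsAgree (x ++ y ++ z) r f fun g => if g ≤ n then f g else
        if g = n + 1 then arm q o (!b) else if g ≤ n + m + 2 then f (g - 2) else
        if g = n + m + 3 then arm q (!o) (!a) else f (g - 4) := by
      rintro g g' hg (⟨h₁, rfl⟩ | ⟨h₁, h₂, rfl⟩ | ⟨h₁, rfl⟩)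
      · dsimp only
        rw [if_pos h₁]
      · dsimp only
        rw [if_neg (by omega), if_neg (by omega), if_pos (by omega), Nat.add_sub_cancel]
      · dsimp only
        rw [if_neg (by omega), if_neg (by omega), if_neg (by omega), if_neg (by omega),
          Nat.add_sub_cancel]
    refine ⟨_, (hcol _ _ ha).2 ⟨hf, ?_⟩, ha⟩
    convert hq.clasp o a b using 1
    · simp [he]
    · simp
    · simp [he]
    · rw [if_neg (by omega), if_neg (by omega), if_pos le_rfl, Nat.add_sub_cancel, hf₀]
    · rw [if_neg (by omega), if_neg (by omega), if_neg (by omega), if_pos rfl]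
    · rw [if_neg (by omega), if_neg (by omega), if_neg (by omega), if_neg (by omega),
        Nat.add_sub_cancel, hf₀]
  · intro f f₁ f₂ hf₁ hf₂ h₁ h₂ g hg
    obtain ⟨q, hq, i₁, i₂, i₃, i₄, i₅, i₆⟩ := (hclasp f₁ hf₁).exists_rule
    obtain ⟨q', hq', j₁, j₂, j₃, j₄, j₅, j₆⟩ := (hclasp f₂ hf₂).exists_rule
    have e : ∀ g₀ g', g₀ ≤ (x ++ y ++ z).length → r g₀ g' → f₁ g' = f₂ g' := fun g₀ g' hg hr =>
      (h₁ g₀ g' hg hr).symm.trans (h₂ g₀ g' hg hr)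
    have hqq : q = q' := by
      refine hq.ext_of_arm hq' (o := o) (a := a) (b := b) ?_ ?_
      · rw [← i₁, ← j₁, e n n (by omega) (.inl ⟨le_rfl, rfl⟩)]
      · rw [← i₄, ← j₄, e (n + m) _ (by omega) (.inr (.inr ⟨le_rfl, rfl⟩))]
    by_cases c₁ : g ≤ n
    · exact e g g (by omega) (.inl ⟨c₁, rfl⟩)
    by_cases c₂ : g = n + 1
    · rw [c₂, i₅, j₅, hqq]
    by_cases c₃ : g ≤ n + m + 2
    · exact e (g - 2) g (by omega) (.inr (.inl ⟨by omega, by omega, by omega⟩))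
    by_cases c₄ : g = n + m + 3
    · rw [c₄, i₆, j₆, hqq]
    · exact e (g - 4) g (by omega) (.inr (.inr ⟨by omega, by omega⟩))
  · intro f' hf'
    obtain ⟨q, hq, i₁, i₂, i₃, i₄, -, -⟩ := (hclasp f' hf').exists_rule
    have ha : GapsAgree (x ++ y ++ z) r (fun g => if g ≤ n then f' g else
        if g ≤ n + m then f' (g + 2) else f' (g + 4)) f' := by
      have k₁ : f' n = f' (n + 2) := i₁.trans i₂.symm
      have k₂ : f' (n + m + 2) = f' (n + m + 4) := i₃.trans i₄.symm
      rintro g g' hg (⟨h₁, rfl⟩ | ⟨h₁, h₂, rfl⟩ | ⟨h₁, rfl⟩)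
      · dsimp only
        rw [if_pos h₁]
      · dsimp only
        split
        · rw [show g = n by omega, k₁]
        · rfl
      · dsimp only
        split
        -- If `y` is empty, both arcs of the move lie on the same gap `n`, whose colors must pass
        -- through both strands of the clasp.
        · obtain ⟨rfl, hm⟩ : g = n ∧ m = 0 := by omega
          rw [hm] at k₂
          exact k₁.trans k₂
        · split
          · rw [show g = n + m by omega, k₂]
          · rfl
    exact ⟨_, ((hcol _ _ ha).1 hf').1, ha⟩
  · intro f' f₁ f₂ _ _ h₁ h₂ g hg
    have e : ∀ g', r g g' → f₁ g = f₂ g := fun g' hr => (h₁ g g' hg hr).trans (h₂ g g' hg hr).symm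
    by_cases c₁ : g ≤ n
    · exact e _ (.inl ⟨c₁, rfl⟩)
    by_cases c₂ : g ≤ n + m
    · exact e _ (.inr (.inl ⟨by omega, c₂, rfl⟩))
    · exact e _ (.inr (.inr ⟨by omega, rfl⟩))
  · intro f f' _ hf' h
    rw [passagesChain_perm R (hperm f f' h), passagesChain_append,
      passagesChain_claspPassages (hclasp f' hf'), add_zero, sub_self]
    exact Submodule.zero_mem _

end Clasp

end TernKnot

namespace TernKnot

/-! ### The third move -/

namespace TripleData

section

variable {X : Type*} {T : X → X → X → X} {R : Type*} [CommRing R] (M : TripleData)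

theorem length_strand (v : Fin 3) : (M.strand v).length = 2 := by
  fin_cases v <;> simp only [strand] <;> split <;> rfl

theorem length_before : M.before.length =
    M.x₀.length + 2 + M.x₁.length + 2 + M.x₂.length + 2 + M.x₃.length := by
  simp [before, length_strand]; omega

theorem entry_order_zero : M.entry (M.order 0) = M.x₀.length := by simp [entry]

theorem entry_order_one : M.entry (M.order 1) = M.x₀.length + 2 + M.x₁.length := by simp [entry]

theorem entry_order_two :
    M.entry (M.order 2) = M.x₀.length + 2 + M.x₁.length + 2 + M.x₂.length := by
  simp [entry]

theorem forall_strand {P : Fin 3 → Prop} :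
    (∀ v, P v) ↔ P (M.order 0) ∧ P (M.order 1) ∧ P (M.order 2) := by
  rw [← M.order.forall_congr_right, Fin.forall_fin_succ, Fin.forall_fin_two]
  rfl

theorem entry_add_two_le (v : Fin 3) : M.entry v + 2 ≤ M.before.length := by
  revert v
  rw [forall_strand, entry_order_zero, entry_order_one, entry_order_two, length_before]
  omega

theorem entry_apart {u v : Fin 3} (h : u ≠ v) :
    M.entry u + 2 ≤ M.entry v ∨ M.entry v + 2 ≤ M.entry u := by
  obtain ⟨i, rfl⟩ := M.order.surjective u
  obtain ⟨j, rfl⟩ := M.order.surjective v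
  fin_cases i <;> fin_cases j <;> simp [entry] at h ⊢ <;> omega

theorem entry_ne (u v : Fin 3) : M.entry u ≠ M.entry v + 1 := by
  by_cases h : u = v
  · subst h; omega
  · have := M.entry_apart h
    omega

theorem entry_add_two_ne (u v : Fin 3) : M.entry u + 2 ≠ M.entry v + 1 := by
  by_cases h : u = v
  · subst h; omega
  · have := M.entry_apart h
    omega

theorem forall_ne_entry_iff {g : ℕ} : (∀ v, g ≠ M.entry v + 1) ↔ g ≠ M.x₀.length + 1 ∧
    g ≠ M.x₀.length + 2 + M.x₁.length + 1 ∧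
      g ≠ M.x₀.length + 2 + M.x₁.length + 2 + M.x₂.length + 1 := by
  rw [M.forall_strand (P := fun v => g ≠ M.entry v + 1), entry_order_zero, entry_order_one,
    entry_order_two]

/-- The passages outside the disk of the move. -/
def outerPassages (f : ℕ → Bool → X) : List (Passage X) :=
  passages f 0 M.x₀ ++ passages f (M.x₀.length + 2) M.x₁ ++
    passages f (M.x₀.length + 2 + M.x₁.length + 2) M.x₂ ++
    passages f (M.x₀.length + 2 + M.x₁.length + 2 + M.x₂.length + 2) M.x₃

/-- The passages inside the disk of the move. -/
def trianglePassages (f : ℕ → Bool → X) : List (Passage X) :=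
  passages f (M.entry 0) (M.strand 0) ++ passages f (M.entry 1) (M.strand 1) ++
    passages f (M.entry 2) (M.strand 2)

/-- In the multiset of passages the order in which the knot runs through the three strands is
irrelevant: the sum over `M.order i` is the sum over all strands. -/
theorem passages_before_perm (f : ℕ → Bool → X) :
    (passages f 0 M.before).Perm (M.outerPassages f ++ M.trianglePassages f) := by
  have h := Equiv.sum_comp M.order
    fun v => (passages f (M.entry v) (M.strand v) : Multiset (Passage X))
  rw [Fin.sum_univ_three, Fin.sum_univ_three, entry_order_zero, entry_order_one,
    entry_order_two] at h
  rw [before, outerPassages, trianglePassages]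
  simp only [passages_append, List.length_append, length_strand, Nat.zero_add, ←
    Multiset.coe_eq_coe, ← Multiset.coe_add, ← h]
  abel

theorem outerPassages_congr {f f' : ℕ → Bool → X}
    (h : ∀ g ≤ M.before.length, (∀ v, g ≠ M.entry v + 1) → f g = f' g) :
    M.outerPassages f = M.outerPassages f' := by
  simp only [forall_ne_entry_iff, length_before] at h
  rw [outerPassages, outerPassages]
  congr 1
  · congr 1
    · congr 1
      · exact passages_congr fun i hi => h _ (by omega) (by omega)
      · exact passages_congr fun i hi => h _ (by omega) (by omega)
    · exact passages_congr fun i hi => h _ (by omega) (by omega)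
  · exact passages_congr fun i hi => h _ (by omega) (by omega)

theorem trianglePassages_partner (f : ℕ → Bool → X) :
    ∀ a ∈ (M.trianglePassages f).map Prod.fst, ∃ b ∈ (M.trianglePassages f).map Prod.fst,
      b.label = a.label ∧ b.isOver = !a.isOver := by
  simp only [trianglePassages, List.map_append, map_fst_passages, strand]
  cases M.firstB <;> cases M.firstM <;> cases M.firstT <;> simp

theorem compat_trianglePassages {f : ℕ → Bool → X} (h₁ : M.mb ≠ M.tb) (h₂ : M.mb ≠ M.tm)
    (h₃ : M.tb ≠ M.tm) : Compat T (M.trianglePassages f) ↔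
      M.Triangle T (fun v => f (M.entry v)) (fun v => f (M.entry v + 1))
        (fun v => f (M.entry v + 2)) := by
  have h₁' := h₁.symm
  have h₂' := h₂.symm
  have h₃' := h₃.symm
  constructor
  · intro h
    have k₁ := h M.mb M.posMB
    have k₂ := h M.tb M.posTB
    have k₃ := h M.tm M.posTM
    simp only [trianglePassages, strand] at k₁ k₂ k₃
    cases hB : M.firstB <;> cases hM : M.firstM <;> cases hT : M.firstT <;>
      simp [passages, Triangle, *] at k₁ k₂ k₃ ⊢
  · rintro ⟨k₁, k₂, k₃⟩ k p u₀ u₁ o₀ o₁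
    simp only [trianglePassages, strand]
    cases hB : M.firstB <;> cases hM : M.firstM <;> cases hT : M.firstT <;>
      simp [hB, hM, hT, passages] at k₁ k₂ k₃ ⊢ <;> grind

theorem passagesChain_trianglePassages (f : ℕ → Bool → X) :
    passagesChain R (M.trianglePassages f) = M.triangleChain R (fun v => f (M.entry v))
      (fun v => f (M.entry v + 1)) (fun v => f (M.entry v + 2)) := by
  rw [trianglePassages, triangleChain]
  simp only [strand]
  cases hB : M.firstB <;> cases hM : M.firstM <;> cases hT : M.firstT <;>
    simp [passagesChain, passages, passageTerm] <;> abel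

theorem labels_ne (hn : NodupKeys M.before) : M.mb ≠ M.tb ∧ M.mb ≠ M.tm ∧ M.tb ≠ M.tm := by
  -- Only the letters matter; a trivial coloring allows the use of `passages_before_perm`.
  let f : ℕ → Bool → Unit := fun _ _ => ()
  have h := (M.passages_before_perm f).map Prod.fst
  rw [map_fst_passages, List.map_append] at h
  have h' := hn.perm h
  rw [NodupKeys, List.map_append] at h'
  replace h' := h'.of_append_right
  simp only [trianglePassages, List.map_append, map_fst_passages, strand] at h'
  cases hB : M.firstB <;> cases hM : M.firstM <;> cases hT : M.firstT <;>
    simp [hB, hM, hT] at h' <;> grind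

theorem isColoring_before_iff (hn : NodupKeys M.before) {f : ℕ → Bool → X} :
    IsColoring T M.before f ↔ f M.before.length = f 0 ∧ Compat T (M.outerPassages f) ∧
      M.Triangle T (fun v => f (M.entry v)) (fun v => f (M.entry v + 1))
        (fun v => f (M.entry v + 2)) := by
  obtain ⟨h₁, h₂, h₃⟩ := M.labels_ne hn
  have hp := M.passages_before_perm f
  have h := hp.map Prod.fst
  rw [map_fst_passages, List.map_append] at h
  rw [IsColoring, compat_perm hp, compat_append (hn.perm h) (M.trianglePassages_partner f),
    M.compat_trianglePassages h₁ h₂ h₃]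

/-- The colors before the move fill a cube. Its faces at the opposite vertex color the new disk;
only the gaps at the triangle change. -/
theorem exists_flip (hT : IsTern T) (hn : NodupKeys M.before) (hn' : NodupKeys M.flip.before)
    {f : ℕ → Bool → X} (hf : IsColoring T M.before f) : ∃ f', IsColoring T M.flip.before f' ∧
      ∀ g, (∀ v, g ≠ M.entry v + 1) → f g = f' g := by
  obtain ⟨h₀, hc, ht⟩ := (M.isColoring_before_iff hn).1 hf
  obtain ⟨col, hcol, hi, -, ho⟩ := ht.exists_isCube M hT
  have ht' := hcol.triangle M.flip
  rw [entryColors_flip, exitColors_flip] at ht'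
  set m := M.flip.midColors col
  obtain ⟨f', hf', hm⟩ : ∃ f' : ℕ → Bool → X, (∀ g, (∀ v, g ≠ M.entry v + 1) → f g = f' g) ∧
      ∀ v, f' (M.entry v + 1) = m v := by
    classical
    refine ⟨fun g => if h : ∃ v, g = M.entry v + 1 then m h.choose else f g, fun g hg => ?_,
      fun v => ?_⟩
    · dsimp only
      rw [dif_neg (by simpa using hg)]
    -- Different strands have entries at least two apart, so the chosen strand is `v`.
    · have h : ∃ u, M.entry v + 1 = M.entry u + 1 := ⟨v, rfl⟩
      have hv : h.choose = v := by
        by_contra hne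
        have := M.entry_apart hne
        have := h.choose_spec
        omega
      dsimp only
      rw [dif_pos h, hv]
  refine ⟨f', (M.flip.isColoring_before_iff hn').2 ⟨?_, ?_, ?_⟩, hf'⟩
  · have hlen : M.flip.before.length = M.before.length := by
      rw [length_before, length_before]; rfl
    rw [hlen, ← hf' 0 (fun v => by omega), ← h₀, hf' _ fun v => by
      have := M.entry_add_two_le v; omega]
  · have : M.flip.outerPassages f' = M.outerPassages f :=
      (M.outerPassages_congr fun g _ => hf' g).symm
    rwa [this]
  · rw [entry_flip]
    convert ht' using 1
    · rw [← hi]; exact funext fun v => (hf' _ (M.entry_ne v)).symm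
    · exact funext hm
    · rw [← ho]; exact funext fun v => (hf' _ (M.entry_add_two_ne v)).symm

theorem eq_of_eq_off_triangle (hT : IsTern T) (hn : NodupKeys M.before) {f₁ f₂ : ℕ → Bool → X}
    (h₁ : IsColoring T M.before f₁) (h₂ : IsColoring T M.before f₂)
    (h : ∀ g ≤ M.before.length, (∀ v, g ≠ M.entry v + 1) → f₁ g = f₂ g) :
    ∀ g ≤ M.before.length, f₁ g = f₂ g := by
  obtain ⟨-, -, t₁⟩ := (M.isColoring_before_iff hn).1 h₁
  obtain ⟨-, -, t₂⟩ := (M.isColoring_before_iff hn).1 h₂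
  obtain ⟨col₁, c₁, i₁, m₁, o₁⟩ := t₁.exists_isCube M hT
  obtain ⟨col₂, c₂, i₂, m₂, o₂⟩ := t₂.exists_isCube M hT
  have hc : col₁ = col₂ := by
    refine M.cube_unique c₁ c₂ ?_ ?_
    · rw [← i₁, ← i₂]
      exact funext fun v => h _ (by have := M.entry_add_two_le v; omega) (M.entry_ne v)
    · rw [← o₁, ← o₂]
      exact funext fun v => h _ (M.entry_add_two_le v) (M.entry_add_two_ne v)
  intro g hg
  by_cases hv : ∀ v, g ≠ M.entry v + 1
  · exact h g hg hv
  · push Not at hv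
    obtain ⟨v, rfl⟩ := hv
    exact (congrFun m₁ v).trans (((congrArg (fun c => M.midColors c v) hc)).trans
      (congrFun m₂ v).symm)

/-- The difference of the chains under a third move is, up to sign, the boundary of the ascending
path of the three strands. -/
theorem exists_passagesChain_sub (R : Type*) [CommRing R] (hT : IsTern T)
    (hn : NodupKeys M.before) (hn' : NodupKeys M.flip.before) {f f' : ℕ → Bool → X}
    (hf : IsColoring T M.before f) (hf' : IsColoring T M.flip.before f')
    (h : ∀ g ≤ M.before.length, (∀ v, g ≠ M.entry v + 1) → f g = f' g) :
    ∃ a b d e : X, (∀ v, f (M.entry v) = M.entryColors (pathCube T a b d e) v) ∧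
      passagesChain R (passages f' 0 M.flip.before) - passagesChain R (passages f 0 M.before) =
        (if M.posMB = M.sideT then (-1 : R) else 1) •
          boundary R T 2 (Finsupp.single ![a, b, d, e] 1) := by
  have hlen : M.flip.before.length = M.before.length := by
    rw [length_before, length_before]; rfl
  obtain ⟨-, -, t₁⟩ := (M.isColoring_before_iff hn).1 hf
  obtain ⟨-, -, t₂⟩ := (M.flip.isColoring_before_iff hn').1 hf'
  obtain ⟨col, c, i₁, m₁, o₁⟩ := t₁.exists_isCube M hT
  obtain ⟨col', c', i₂, m₂, o₂⟩ := t₂.exists_isCube M.flip hT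
  rw [entryColors_flip] at i₂
  rw [exitColors_flip] at o₂
  rw [entry_flip] at i₂ m₂ o₂
  -- The cubes obtained on the two sides of the move have the same colors along the gaps outside the
  -- disk, so they coincide.
  obtain rfl : col = col' := by
    refine M.cube_unique c c' ?_ ?_
    · rw [← i₁, ← i₂]
      exact funext fun v => h _ (by have := M.entry_add_two_le v; omega) (M.entry_ne v)
    · rw [← o₁, ← o₂]
      exact funext fun v => h _ (M.entry_add_two_le v) (M.entry_add_two_ne v)
  have hout : M.flip.outerPassages f' = M.outerPassages f := (M.outerPassages_congr h).symm
  refine ⟨col false false false, col true false false, col true true false, col true true true,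
    fun v => ?_, ?_⟩
  · rw [← c.eq_pathCube, ← i₁]
  · rw [passagesChain_perm R (M.passages_before_perm f),
      passagesChain_perm R (M.flip.passages_before_perm f'), passagesChain_append,
      passagesChain_append, hout, add_sub_add_left_eq_sub, passagesChain_trianglePassages,
      passagesChain_trianglePassages, entry_flip, i₁, m₁, o₁, i₂, m₂, o₂]
    have := M.triangleChain_sub R (T := T) (col false false false) (col true false false)
      (col true true false) (col true true true)
    rwa [← c.eq_pathCube] at this

end

end TripleData

/-! ### Invariance of the homology class under all moves. -/

section

variable {X : Type*} {T : X → X → X → X} {R : Type*} [CommRing R]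

theorem transport_three (hT : IsTern T) (M : TripleData) (hn : NodupKeys M.before)
    (hn' : NodupKeys M.after) :
    Transport T R M.before M.after fun g g' => g' = g ∧ ∀ v, g ≠ M.entry v + 1 := by
  rw [← M.before_flip] at *
  have hlen : M.flip.before.length = M.before.length := by
    rw [M.length_before, M.flip.length_before]; rfl
  refine ⟨?_, ?_, ?_, ?_, ?_, ?_⟩
  · rintro g _ hg ⟨rfl, -⟩
    exact hlen ▸ hg
  · intro f hf _
    obtain ⟨f', hf', h⟩ := M.exists_flip hT hn hn' hf
    exact ⟨f', hf', by rintro _ g - ⟨rfl, hg⟩; exact h g hg⟩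
  · intro f f₁ f₂ hf₁ hf₂ h₁ h₂
    refine M.flip.eq_of_eq_off_triangle hT hn' hf₁ hf₂ fun g hg hv => ?_
    exact (h₁ g g (hlen ▸ hg) ⟨rfl, hv⟩).symm.trans (h₂ g g (hlen ▸ hg) ⟨rfl, hv⟩)
  · intro f' hf'
    have e : M.flip.flip.before = M.before := by rw [M.flip.before_flip, M.after_flip]
    obtain ⟨f, hf, h⟩ := M.flip.exists_flip hT hn' (by rwa [e]) hf'
    rw [e] at hf
    exact ⟨f, hf, by rintro _ g - ⟨rfl, hg⟩; exact (h g hg).symm⟩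
  · intro f' f₁ f₂ hf₁ hf₂ h₁ h₂
    exact M.eq_of_eq_off_triangle hT hn hf₁ hf₂ fun g hg hv =>
      (h₁ g g hg ⟨rfl, hv⟩).trans (h₂ g g hg ⟨rfl, hv⟩).symm
  · intro f f' hf hf' h
    obtain ⟨a, b, d, e, -, he⟩ := M.exists_passagesChain_sub R hT hn hn' hf hf'
      fun g hg hv => h g g hg ⟨rfl, hv⟩
    rw [← neg_sub, he]
    exact Submodule.neg_mem _ (Submodule.mem_sup_right
      (Submodule.smul_mem _ _ (LinearMap.mem_range_self _ _)))

/-- Every move transports colorings. -/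
theorem Move.transport (hT : IsTern T) {w w' : List Letter} {r : ℕ → ℕ → Prop}
    (h : Move w w' r) (hn : NodupKeys w) (hn' : NodupKeys w') : Transport T R w w' r := by
  cases h with
  | rotate x y => exact transport_rotate x y
  | relabel w f => exact transport_relabel w f
  | one x y k o p => exact transport_one hT x y k o p hn'
  | two x y z k l o a b h => exact transport_two hT x y z k l o a b h hn'
  | three M => exact transport_three hT M hn hn'

theorem exists_homologyClass_eq {P Q : (D : KnotDiagram) × Coloring T D}
    (h : normKnotChain R P.2 - normKnotChain R Q.2 ∈ normBoundaries R T 1) :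
    ∃ (hP : normKnotChain R P.2 ∈ normCycles R T 1) (hQ : normKnotChain R Q.2 ∈ normCycles R T 1),
      homologyClass R T 1 ⟨_, hP⟩ = homologyClass R T 1 ⟨_, hQ⟩ :=
  ⟨normKnotChain_mem R P.2, normKnotChain_mem R Q.2, (Submodule.Quotient.eq _).2 h⟩

theorem normKnotChain_sub_mem_of_eqvGen (hT : IsTern T) {P Q : (D : KnotDiagram) × Coloring T D}
    (h : Relation.EqvGen (ColoredMove T) P Q) :
    normKnotChain R P.2 - normKnotChain R Q.2 ∈ normBoundaries R T 1 := by
  induction h with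
  | rel P Q h =>
    obtain ⟨r, hm, ha⟩ := h
    exact (hm.transport hT P.1.nodup Q.1.nodup).normKnotChain_sub_mem ha
  | refl P => rw [sub_self]; exact Submodule.zero_mem _
  | symm P Q _ ih => rw [← neg_sub]; exact Submodule.neg_mem _ ih
  | trans P Q S _ _ h₁ h₂ => rw [← sub_add_sub_cancel]; exact Submodule.add_mem _ h₁ h₂

end

end TernKnot


theorem mainTheorem5 {X : Type*} {T : X → X → X → X} (hT : TernKnot.IsTern T)
    (R : Type*) [CommRing R] :
    -- the chain of a colored diagram is a cycle of tern homology
    (∀ (D : TernKnot.KnotDiagram) (c : TernKnot.Coloring T D),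
      TernKnot.normKnotChain R c ∈ TernKnot.normCycles R T 1) ∧
    -- across a move, in either direction, a coloring carries over in exactly one way
    (∀ (D D' : TernKnot.KnotDiagram) (r : ℕ → ℕ → Prop), TernKnot.Move D.code D'.code r →
      (∀ c : TernKnot.Coloring T D, ∃! c' : TernKnot.Coloring T D', TernKnot.Agree r c c') ∧
      (∀ c' : TernKnot.Coloring T D', ∃! c : TernKnot.Coloring T D, TernKnot.Agree r c c')) ∧
    -- the homology class is invariant under finite sequences of moves and inverse moves
    (∀ P Q : (D : TernKnot.KnotDiagram) × TernKnot.Coloring T D,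
      Relation.EqvGen (TernKnot.ColoredMove T) P Q →
      ∃ (hP : TernKnot.normKnotChain R P.2 ∈ TernKnot.normCycles R T 1)
        (hQ : TernKnot.normKnotChain R Q.2 ∈ TernKnot.normCycles R T 1),
        TernKnot.homologyClass R T 1 ⟨_, hP⟩ = TernKnot.homologyClass R T 1 ⟨_, hQ⟩) ∧
    -- the difference of the chains under a third move is a boundary of a single tuple up to sign,
    -- and for three positive crossings it is the boundary of the ascending path of the three strands
    (∀ (M : TernKnot.TripleData) (D D' : TernKnot.KnotDiagram) (c : TernKnot.Coloring T D)
      (c' : TernKnot.Coloring T D'), D.code = M.before → D'.code = M.after →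
      TernKnot.Agree (fun g g' => g' = g ∧ ∀ v, g ≠ M.entry v + 1) c c' →
      (∃ x : Fin 4 → X,
        TernKnot.knotChain R c' - TernKnot.knotChain R c =
            TernKnot.boundary R T 2 (Finsupp.single x 1) ∨
        TernKnot.knotChain R c' - TernKnot.knotChain R c =
            -TernKnot.boundary R T 2 (Finsupp.single x 1)) ∧
      (M.posMB = true → M.posTB = true → M.posTM = true → M.sideM = true →
        ∃ a b d e : X,
          c.color (TernKnot.region D.code (M.entry 0) false) = a ∧
          c.color (TernKnot.region D.code (M.entry 0) true) = b ∧
          c.color (TernKnot.region D.code (M.entry 1) false) = b ∧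
          c.color (TernKnot.region D.code (M.entry 1) true) = d ∧
          c.color (TernKnot.region D.code (M.entry 2) false) = d ∧
          c.color (TernKnot.region D.code (M.entry 2) true) = e ∧
          TernKnot.knotChain R c' - TernKnot.knotChain R c =
            Finsupp.single ![b, d, e] 1 - Finsupp.single ![a, T a b d, T (T a b d) d e] 1
            - Finsupp.single ![T a b d, d, e] 1 + Finsupp.single ![a, b, T b d e] 1
            + Finsupp.single ![T a b (T b d e), T b d e, e] 1 - Finsupp.single ![a, b, d] 1 ∧
          TernKnot.knotChain R c' - TernKnot.knotChain R c =
            TernKnot.boundary R T 2 (Finsupp.single ![a, b, d, e] 1))) := by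
  refine ⟨fun D c => TernKnot.normKnotChain_mem R c, fun D D' r h => ?_, fun P Q h =>
    TernKnot.exists_homologyClass_eq (TernKnot.normKnotChain_sub_mem_of_eqvGen hT h),
    fun M D D' c c' hD hD' h => ?_⟩
  · have ht : TernKnot.Transport T R D.code D'.code r := h.transport hT D.nodup D'.nodup
    exact ⟨ht.existsUnique_right, ht.existsUnique_left⟩
  · have hn := D.nodup
    have hn' := D'.nodup
    have hc := c.isColoring
    have hc' := c'.isColoring
    rw [TernKnot.agree_iff] at h
    rw [← M.before_flip] at hD'
    rw [hD] at hn hc h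
    rw [hD'] at hn' hc'
    obtain ⟨a, b, d, e, hcol, hsub⟩ := M.exists_passagesChain_sub R hT hn hn' hc hc'
      fun g hg hv => h g g hg ⟨rfl, hv⟩
    rw [← hD, ← hD', ← TernKnot.knotChain_eq, ← TernKnot.knotChain_eq] at hsub
    rw [hsub]
    refine ⟨⟨![a, b, d, e], ?_⟩, fun h₁ h₂ h₃ h₄ => ?_⟩
    · split
      · right; rw [neg_smul, one_smul]
      · left; rw [one_smul]
    -- Three positive signs and a triangle on the left of the middle strand force it to lie on the
    -- right of the other two, and every `first` flag is true. The incoming gaps then run along the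
    -- edges of the path `a`, `b`, `d`, `e`, and since `posMB` differs from `sideT` the sign is
    -- `+1`.
    · obtain ⟨k₁, k₂, k₃, k₄, k₅⟩ := M.eq_xor
      rw [h₁, h₂, h₄] at k₁
      rw [h₁, h₃] at k₂
      rw [h₁, h₄] at k₃
      have hsT : M.sideT = false := by simpa using k₁
      have hsB : M.sideB = false := by simpa [hsT] using k₂
      have key : ∀ v s, c.color (TernKnot.region D.code (M.entry v) s) =
          M.entryColors (TernKnot.pathCube T a b d e) v s := fun v s => congrFun (hcol v) s
      simp only [key, TernKnot.TripleData.entryColors, h₁, h₄, hsT, hsB, k₃, k₄, k₅]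
      refine ⟨a, b, d, e, rfl, rfl, rfl, rfl, rfl, rfl, ?_, ?_⟩
      · rw [← TernKnot.boundary_two_single]
        simp
      · simp
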